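/- **Setting.** Let $N\ge 1$, $\gamma>0$ and $0<\lambda\le\Lambda<\infty$ be fixed, and let $B_r$ be the open ball of radius $r$ centred at $0$ in $\mathbb R^N$. For $\sigma\in(0,2)$ let $C_{N,\sigma}=\Big(\int_{\mathbb R^N}\frac{1-\cos\zeta_1}{|\zeta|^{N+\sigma}}\,d\zeta\Big)^{-1}$ be the normalizing constant of the fractional Laplacian $\Delta^{\sigma/2}$. Let $\mathcal K_0=\mathcal K_0(\sigma)$ be the set of measurable symmetric kernels $K$ on $\mathbb R^N\setminus\{0\}$ (that is, $K(-z)=K(z)$) with $\lambda C_{N,\sigma}|z|^{-N-\sigma}\le K(z)\le\Lambda C_{N,\sigma}|z|^{-N-\sigma}$ for $z\neq 0$. For $A\subseteq\mathbb R^N$ put $I_K[A](v,x)=\mathrm{P.V.}\int_A (v(x+z)-v(x))K(z)\,dz$. For a non-empty two-parameter family $\{K_{ij}\}\subset\mathcal K_0(\sigma)$ put $\mathcal I_\sigma(u,x)=\inf_i\sup_j I_{K_{ij}}[\mathbb R^N](u,x)$ and $$\mathcal I_{\delta}(u,\varphi,x)=\inf_i\sup_j\big(I_{K_{ij}}[B_\delta](\varphi,x)+I_{K_{ij}}[B_\delta^c](u,x)\big).$$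 For $p\in\mathbb R^N$, an upper semicontinuous $u:\mathbb R^N\to\mathbb R$ is a viscosity solution of $-|Du+p|^\gamma\mathcal I_\sigma(u)\le f$ in $B_1$ if $-|D\varphi(x)+p|^\gamma\,\mathcal I_{\delta}(u,\varphi,x)\le f(x)$ whenever $x\in B_1$, $\varphi\in C^2(\mathbb R^N)$, $\delta>0$, $u-\varphi$ attains its maximum over the ball $B_\delta(x)$ at $x$, and $D\varphi(x)\ne-p$. The inequality $-|Du+p|^\gamma\mathcal I_\sigma(u)\ge f$ is defined analogously, with $u$ lower semicontinuous and minima in place of maxima. A function satisfies a two-sided inequality if it satisfies both one-sided ones. **Lemma 3.1 (approximation lemma).** For every $M>0$, $\epsilon,\alpha\in(0,1)$ and every modulus of continuity $\omega:[0,\infty)\to[0,\infty)$ (only $\omega(0)=0$ and $\omega(t)\to0$ as $t\to0^+$ are required) there exist $\eta\in(0,1)$ and $\sigma_0\in(1+\alpha,2)$ with the following property. Let $p\in\mathbb R^N$, and let $u:\mathbb R^N\to\mathbb R$ be a viscosity solution of $$-\eta\le-|Du+p|^\gamma\,\mathcal I_\sigma(u)\le\eta\quad\text{in }B_1,$$ where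 * (i) $\sigma\in(\sigma_0,2)$, $\mathcal I_\sigma$ is given by a family $\{K_{ij}\}\subset\mathcal K_0(\sigma)$, and $\{k_{ij}\}\subset[\lambda,\Lambda]$ are numbers with $$\Big|\frac{K_{ij}(x)\,|x|^{N+\sigma}}{C_{N,\sigma}}-k_{ij}\Big|\le\omega(|x|)\quad\text{for }0<|x|\le1\text{ and all }i,j;$$ * (ii) $|u(x)-u(y)|\le\omega(|x-y|)$ for $x,y\in\overline{B_1}$; * (iii) $|u(x)|\le M(1+|x|^{1+\alpha})$ for $x\in\mathbb R^N$. Then there exists a continuous viscosity solution $h$ of $$-|Dh|^\gamma\,\inf_i\sup_j\big(k_{ij}\,\mathrm{Tr}(D^2h)\big)=0\quad\text{in }B_1$$ such that $\sup_{B_1}|u-h|\le\epsilon$. (The numbers $\eta,\sigma_0$ may depend on $N,\gamma,\lambda,\Lambda,M,\epsilon,\alpha,\omega$, but not on $p$, $u$, $\sigma$, the index sets, the kernels or the $k_{ij}$.) -/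

import Mathlib

open MeasureTheory Filter Topology Metric
open scoped NNReal

namespace NonlocalIsaacs

/-- Euclidean space `ℝ^N`. -/
abbrev E (N : ℕ) := EuclideanSpace ℝ (Fin N)

/-- The normalizing constant `C_{N,σ} = (∫ (1 - cos ζ₁) / |ζ|^{N+σ} dζ)⁻¹` of the fractional
Laplacian: the kernel `C_{N,σ} |z|^{-(N+σ)}` has operator `Δ^{σ/2} = -(-Δ)^{σ/2}`
(Fourier symbol `-|ξ|^σ`). -/
noncomputable def normConst (N : ℕ) [NeZero N] (σ : ℝ) : ℝ :=
  (∫ ζ : E N, (1 - Real.cos (ζ 0)) / ‖ζ‖ ^ ((N : ℝ) + σ))⁻¹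

/-- The class `𝒦₀`: measurable symmetric kernels on `ℝ^N ∖ {0}` with
`lam C_{N,σ} / |z|^{N+σ} ≤ K z ≤ Lam C_{N,σ} / |z|^{N+σ}`. The value at `0` is irrelevant. -/
structure IsEllipticKernel {N : ℕ} [NeZero N] (lam Lam σ : ℝ) (K : E N → ℝ) : Prop where
  measurable : Measurable K
  symm : ∀ z, z ≠ 0 → K (-z) = K z
  lower : ∀ z, z ≠ 0 → lam * (normConst N σ / ‖z‖ ^ ((N : ℝ) + σ)) ≤ K z
  upper : ∀ z, z ≠ 0 → K z ≤ Lam * (normConst N σ / ‖z‖ ^ ((N : ℝ) + σ))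

/-- `I_K[A](v, x) = P.V. ∫_A (v (x + z) - v x) K z dz`, the Cauchy principal value at `z = 0`. -/
noncomputable def linOp {N : ℕ} (K : E N → ℝ) (A : Set (E N)) (v : E N → ℝ) (x : E N) : ℝ :=
  limUnder (𝓝[>] (0 : ℝ)) (fun r => ∫ z in A \ ball 0 r, (v (x + z) - v x) * K z)

/-- `𝓘_δ(u, φ, x) = inf_i sup_j (I_{K_ij}[B_δ](φ, x) + I_{K_ij}[B_δᶜ](u, x))`. -/
noncomputable def isaacsEval {N : ℕ} {ι κ : Type*} (K : ι → κ → E N → ℝ) (δ : ℝ)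
    (u φ : E N → ℝ) (x : E N) : ℝ :=
  ⨅ i, ⨆ j, (linOp (K i j) (ball 0 δ) φ x + linOp (K i j) (ball 0 δ)ᶜ u x)

/-- Viscosity subsolution of `-|Du + p|^γ 𝓘(u) = f` in `B_1`. Test functions with
`Dφ(x) = -p` are not used; `B_δ(x)` is a ball on which `u - φ` is maximal at `x`. -/
structure IsNonlocalSubsolution {N : ℕ} {ι κ : Type*} (γ : ℝ) (p : E N)
    (K : ι → κ → E N → ℝ) (f u : E N → ℝ) : Prop where
  usc : UpperSemicontinuous u
  test : ∀ x ∈ ball (0 : E N) 1, ∀ φ : E N → ℝ, ContDiff ℝ 2 φ → ∀ δ > 0,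
    (∀ y ∈ ball x δ, u y - φ y ≤ u x - φ x) → gradient φ x ≠ -p →
    -(‖gradient φ x + p‖ ^ γ * isaacsEval K δ u φ x) ≤ f x

/-- Viscosity supersolution of `-|Du + p|^γ 𝓘(u) = f` in `B_1`. -/
structure IsNonlocalSupersolution {N : ℕ} {ι κ : Type*} (γ : ℝ) (p : E N)
    (K : ι → κ → E N → ℝ) (f u : E N → ℝ) : Prop where
  lsc : LowerSemicontinuous u
  test : ∀ x ∈ ball (0 : E N) 1, ∀ φ : E N → ℝ, ContDiff ℝ 2 φ → ∀ δ > 0,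
    (∀ y ∈ ball x δ, u x - φ x ≤ u y - φ y) → gradient φ x ≠ -p →
    f x ≤ -(‖gradient φ x + p‖ ^ γ * isaacsEval K δ u φ x)

/-- The local operator `-|Dφ(x)|^γ inf_i sup_j (k_ij Tr D²φ(x))`. -/
noncomputable def limitEval {N : ℕ} {ι κ : Type*} (γ : ℝ) (k : ι → κ → ℝ)
    (φ : E N → ℝ) (x : E N) : ℝ :=
  -(‖gradient φ x‖ ^ γ * ⨅ i, ⨆ j, k i j * Laplacian.laplacian φ x)

/-- `h` is a (continuous) viscosity solution of `-|Dh|^γ inf_i sup_j (k_ij Tr D²h) = 0` in `B_1`.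
Only the values of `h` in `B_1` matter. -/
structure IsLimitSolution {N : ℕ} {ι κ : Type*} (γ : ℝ) (k : ι → κ → ℝ)
    (h : E N → ℝ) : Prop where
  cont : ContinuousOn h (ball 0 1)
  sub : ∀ x ∈ ball (0 : E N) 1, ∀ φ : E N → ℝ, ContDiff ℝ 2 φ →
    IsLocalMax (fun y => h y - φ y) x → limitEval γ k φ x ≤ 0
  super : ∀ x ∈ ball (0 : E N) 1, ∀ φ : E N → ℝ, ContDiff ℝ 2 φ →
    IsLocalMin (fun y => h y - φ y) x → 0 ≤ limitEval γ k φ x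

end NonlocalIsaacs

open NonlocalIsaacs

/-! The numbers `k i j` are positive, so `inf_i sup_j (k i j * t)` has the sign of `t`, and every
viscosity-harmonic function solves the limit equation, whatever `γ` and the `k i j` are. It
therefore suffices that `u` be close to a harmonic function (`exists_viscosityHarmonic_near`); no
limit of kernels or index sets is needed. This is proved by contradiction and Arzelà-Ascoli, along
sequences `η n → 0`, `σ n → 2`.

As `σ → 2` the normalizing constant tends to `0`, while the normalized kernel keeps its second
moment near the origin. All linear operators evaluated on `φ` near `x₀` are then within a small
fraction of `a * k * Δφ(x₀)`, with `a ≥ 1/(4N)` (`exists_linOp_estimate`). If `Δφ(x₀) < 0`, the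
Isaacs operator is at most some `-m < 0`, and the equation at a contact point from above gives `|Dφ
+ p|^γ m ≤ η`: the gradient is nearly `-p`.

The vectors `p n` are not bounded a priori. But one contact of the limit from above with `Δφ(x₀) <
0` already forces `p n → -Dφ(x₀)` (`tendsto_of_contact`), so all such contacts share one gradient
`q`. That is impossible (`laplacian_nonneg_of_gradient_eq`): translating the test function `ψ` by `b
• a`, the contact level `max (w - ψ(· - b • a))` would change at rate `q·a`; yet `Δψ(x₀) < 0`
permits a choice of `a` with `ψ(x₀ - a) + q·a < ψ(x₀)`, so that the level grows by more than `q·a`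
between `b = 0` and `b = 1`. Contacts from below reduce to this case through `-u n` and `-p n`. -/

namespace NonlocalIsaacs

/-! ### Moments and tails of the kernels `|z|^{-(N+σ)}`. -/

/-- The second moment of `|z|^{-(N+σ)}` over the ball of radius `δ`. -/
noncomputable def ballMoment (N : ℕ) (δ σ : ℝ) : ℝ :=
  ∫ z in ball (0 : E N) δ, ‖z‖ ^ 2 / ‖z‖ ^ ((N : ℝ) + σ)

lemma pow_mul_moment_eq {N : ℕ} [NeZero N] {σ y : ℝ} (hy : 0 < y) :
    y ^ (Module.finrank ℝ (E N) - 1) • (y ^ 2 / y ^ ((N : ℝ) + σ)) = y ^ (1 - σ) := by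
  have hN : 1 ≤ N := NeZero.one_le
  rw [finrank_euclideanSpace_fin, smul_eq_mul, ← Real.rpow_natCast, ← Real.rpow_natCast,
    ← Real.rpow_sub hy, ← Real.rpow_add hy]
  congr 1
  push_cast [hN]
  ring

lemma integrableOn_ballMoment {N : ℕ} [NeZero N] (δ : ℝ) {σ : ℝ} (hσ : σ < 2) :
    IntegrableOn (fun z : E N => ‖z‖ ^ 2 / ‖z‖ ^ ((N : ℝ) + σ)) (ball 0 δ) := by
  rw [integrableOn_fun_norm_addHaar volume (f := fun y => y ^ 2 / y ^ ((N : ℝ) + σ))]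
  rcases le_or_gt δ 0 with h | h
  · simp [Set.Ioo_eq_empty_of_le h]
  rw [integrableOn_congr_fun (fun y hy => pow_mul_moment_eq hy.1) measurableSet_Ioo]
  have := (intervalIntegral.intervalIntegrable_rpow' (a := 0) (b := δ) (r := 1 - σ) (by linarith))
  rw [intervalIntegrable_iff_integrableOn_Ioo_of_le h.le] at this
  exact this

lemma ballMoment_eq {N : ℕ} [NeZero N] {δ σ : ℝ} (hδ : 0 < δ) (hσ : σ < 2) :
    ballMoment N δ σ = N * volume.real (ball (0 : E N) 1) * (δ ^ (2 - σ) / (2 - σ)) := by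
  unfold ballMoment
  have h := integral_fun_norm_addHaar (volume : Measure (E N))
    ((Set.Iio δ).indicator fun y => y ^ 2 / y ^ ((N : ℝ) + σ))
  have h1 : (fun z : E N => (Set.Iio δ).indicator (fun y => y ^ 2 / y ^ ((N : ℝ) + σ)) ‖z‖)
      = (ball (0 : E N) δ).indicator fun z => ‖z‖ ^ 2 / ‖z‖ ^ ((N : ℝ) + σ) := by
    ext z
    simp [Set.indicator]
  rw [h1, integral_indicator measurableSet_ball] at h
  rw [h, finrank_euclideanSpace_fin]
  have h2 : ∫ y in Set.Ioi (0 : ℝ),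
      y ^ (N - 1) • (Set.Iio δ).indicator (fun y => y ^ 2 / y ^ ((N : ℝ) + σ)) y
      = ∫ y in Set.Ioi (0 : ℝ), (Set.Iio δ).indicator (fun y => y ^ (1 - σ)) y := by
    refine setIntegral_congr_fun measurableSet_Ioi fun y hy => ?_
    by_cases hyd : y < δ
    · have := pow_mul_moment_eq (N := N) (σ := σ) hy
      rw [finrank_euclideanSpace_fin] at this
      simpa [Set.indicator, hyd] using this
    · simp [Set.indicator, hyd]
  rw [h2, setIntegral_indicator measurableSet_Iio, Set.Ioi_inter_Iio,
    ← integral_Ioc_eq_integral_Ioo, ← intervalIntegral.integral_of_le hδ.le,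
    integral_rpow (Or.inl (by linarith))]
  have h3 : (1 - σ + 1) = 2 - σ := by ring
  rw [h3, Real.zero_rpow (by linarith)]
  simp [mul_assoc]

/-- The moment over a fixed ball blows up like `1/(2-σ)`. This divergence is what concentrates the
normalized kernel at the origin. -/
lemma le_ballMoment {N : ℕ} [NeZero N] {δ σ : ℝ} (hδ : 0 < δ) (hδ1 : δ ≤ 1) (hσ1 : 1 ≤ σ)
    (hσ : σ < 2) :
    N * volume.real (ball (0 : E N) 1) * δ * (2 - σ)⁻¹ ≤ ballMoment N δ σ := by
  rw [ballMoment_eq hδ hσ, mul_assoc, div_eq_mul_inv]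
  have h0 : 0 < 2 - σ := by linarith
  have h : δ ≤ δ ^ (2 - σ) := by
    conv_lhs => rw [← Real.rpow_one δ]
    exact Real.rpow_le_rpow_of_exponent_ge hδ hδ1 (by linarith)
  gcongr

lemma volume_real_unitBall_pos {N : ℕ} : 0 < volume.real (ball (0 : E N) 1) :=
  Measure.real_def _ _ ▸ ENNReal.toReal_pos (measure_ball_pos _ _ one_pos).ne'
    measure_ball_lt_top.ne

/-- Pointwise bound for the tails of the kernels `|z|^{-(N+σ)}`, uniform in `σ ≥ s`. -/
lemma inv_norm_rpow_le {N : ℕ} {δ s σ : ℝ} (hδ : 0 < δ) (hs : 0 ≤ s) (hsσ : s ≤ σ)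
    (hσ : σ < 2) {z : E N} (hz : δ ≤ ‖z‖) :
    1 / ‖z‖ ^ ((N : ℝ) + σ) ≤
      (1 + δ⁻¹) ^ ((N : ℝ) + 2) * (1 + ‖z‖) ^ (-((N : ℝ) + s)) := by
  have hz0 : 0 < ‖z‖ := hδ.trans_le hz
  have hN : (0 : ℝ) ≤ N := N.cast_nonneg
  -- Off the ball `1 + ‖z‖` and `‖z‖` are comparable; bounding the exponent `N + σ` by `N + 2` makes
  -- the constant independent of `σ`.
  have h1 : 1 + ‖z‖ ≤ (1 + δ⁻¹) * ‖z‖ := by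
    have : 1 ≤ δ⁻¹ * ‖z‖ := by
      rw [← div_eq_inv_mul, le_div_iff₀ hδ]; linarith
    linarith
  have h2 : (1 + ‖z‖) ^ ((N : ℝ) + s) ≤ (1 + δ⁻¹) ^ ((N : ℝ) + 2) * ‖z‖ ^ ((N : ℝ) + σ) :=
    calc (1 + ‖z‖) ^ ((N : ℝ) + s) ≤ (1 + ‖z‖) ^ ((N : ℝ) + σ) :=
          Real.rpow_le_rpow_of_exponent_le (by linarith) (by linarith)
      _ ≤ ((1 + δ⁻¹) * ‖z‖) ^ ((N : ℝ) + σ) :=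
          Real.rpow_le_rpow (by positivity) h1 (by linarith)
      _ = (1 + δ⁻¹) ^ ((N : ℝ) + σ) * ‖z‖ ^ ((N : ℝ) + σ) :=
          Real.mul_rpow (by positivity) hz0.le
      _ ≤ _ := by
          gcongr
          · have : 0 < δ⁻¹ := by positivity
            linarith
  rw [Real.rpow_neg (by positivity), ← div_eq_mul_inv, div_le_div_iff₀ (by positivity)
    (by positivity)]
  linarith

lemma integrable_tail {N : ℕ} {β : ℝ} (hβ : 0 < β) :
    Integrable (fun z : E N => (1 + ‖z‖) ^ (-((N : ℝ) + β))) :=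
  integrable_one_add_norm (by rw [finrank_euclideanSpace_fin]; linarith)

/-! ### Averages of quadratic forms against radial weights. -/

/-- The rotation-invariant second moments of a radial weight. -/
lemma integral_inner_mul_inner_isometry {N : ℕ} (f : ℝ → ℝ) (U : E N ≃ₗᵢ[ℝ] E N) (a b : E N) :
    ∫ z : E N, inner ℝ (U a) z * inner ℝ (U b) z * f ‖z‖ =
      ∫ z : E N, inner ℝ a z * inner ℝ b z * f ‖z‖ := by
  have h := U.measurePreserving.integral_comp U.toHomeomorph.measurableEmbedding
    (fun z : E N => inner ℝ (U a) z * inner ℝ (U b) z * f ‖z‖)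
  rw [← h]
  simp

/-- The reflection that negates `e_i` and fixes `e_j` turns the integral into its negative. -/
lemma integral_coord_mul_coord_of_ne {N : ℕ} (f : ℝ → ℝ) {i j : Fin N} (hij : i ≠ j) :
    ∫ z : E N, z i * z j * f ‖z‖ = 0 := by
  have h := integral_inner_mul_inner_isometry f
    (ℝ ∙ (EuclideanSpace.single i (1 : ℝ) : E N))ᗮ.reflection
    (EuclideanSpace.single i 1) (EuclideanSpace.single j 1)
  rw [Submodule.reflection_orthogonalComplement_singleton_eq_neg,
    Submodule.reflection_mem_subspace_eq_self] at h
  · simp only [inner_neg_left, EuclideanSpace.inner_single_left, map_one, one_mul, neg_mul,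
      integral_neg] at h
    linarith
  · rw [Submodule.mem_orthogonal_singleton_iff_inner_right]
    simp [EuclideanSpace.inner_single_left, hij]

/-- The reflection in the hyperplane orthogonal to `e_j - e_i` exchanges the two coordinates. -/
lemma integral_coord_sq_eq {N : ℕ} (f : ℝ → ℝ) (i j : Fin N) :
    ∫ z : E N, z i * z i * f ‖z‖ = ∫ z : E N, z j * z j * f ‖z‖ := by
  have h := integral_inner_mul_inner_isometry f
    (ℝ ∙ ((EuclideanSpace.single j (1 : ℝ) : E N) - EuclideanSpace.single i 1))ᗮ.reflection
    (EuclideanSpace.single j 1) (EuclideanSpace.single j 1)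
  rw [Submodule.reflection_sub (by simp)] at h
  simpa [EuclideanSpace.inner_single_left] using h

/-- Integral of a bilinear form against a radial weight. -/
lemma integral_bilin_mul_radial {N : ℕ} [NeZero N] (f : ℝ → ℝ)
    (hf : Integrable fun z : E N => ‖z‖ ^ 2 * f ‖z‖) (hfm : Measurable f)
    (B : E N →L[ℝ] E N →L[ℝ] ℝ) :
    ∫ z : E N, B z z * f ‖z‖ =
      (∑ i, B (EuclideanSpace.single i 1) (EuclideanSpace.single i 1)) / N *
        ∫ z : E N, ‖z‖ ^ 2 * f ‖z‖ := by
  have hint : ∀ i j : Fin N, Integrable fun z : E N => z i * z j * f ‖z‖ := by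
    intro i j
    refine hf.mono (by fun_prop) (Eventually.of_forall fun z => ?_)
    have h1 := PiLp.norm_apply_le z i
    have h2 := PiLp.norm_apply_le z j
    rw [norm_mul, norm_mul, norm_mul, norm_pow, norm_norm, pow_two]
    gcongr
  have hB : ∀ z : E N, B z z * f ‖z‖ = ∑ i, ∑ j,
      B (EuclideanSpace.single i 1) (EuclideanSpace.single j 1) * (z i * z j * f ‖z‖) := by
    intro z
    have hz : z = ∑ i, z i • (EuclideanSpace.single i (1 : ℝ) : E N) := by
      ext k
      simp [Finset.sum_apply, Pi.single_apply]
    conv_lhs => rw [hz]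
    simp only [map_sum, map_smul, FunLike.coe_sum, Finset.sum_apply,
      FunLike.coe_smul, Pi.smul_apply, smul_eq_mul, Finset.sum_mul]
    rw [← hz, Finset.sum_comm]
    refine Finset.sum_congr rfl fun i _ => ?_
    rw [Finset.mul_sum, Finset.sum_mul]
    exact Finset.sum_congr rfl fun j _ => by ring
  have hsq : ∀ i, ∫ z : E N, z i * z i * f ‖z‖ = (∫ z : E N, ‖z‖ ^ 2 * f ‖z‖) / N := by
    intro i
    have hN : (N : ℝ) ≠ 0 := by exact_mod_cast NeZero.ne N
    rw [eq_div_iff hN]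
    have : ∀ z : E N, ‖z‖ ^ 2 * f ‖z‖ = ∑ j, z j * z j * f ‖z‖ := by
      intro z
      rw [EuclideanSpace.real_norm_sq_eq, Finset.sum_mul]
      simp [pow_two]
    simp_rw [this]
    rw [integral_finsetSum _ fun j _ => hint j j,
      Finset.sum_congr rfl fun j _ => integral_coord_sq_eq f j i]
    simp [mul_comm]
  simp_rw [hB]
  rw [integral_finsetSum _ fun i _ => integrable_finsetSum _ fun j _ => (hint i j).const_mul _,
    Finset.sum_div, Finset.sum_mul]
  refine Finset.sum_congr rfl fun i _ => ?_
  rw [integral_finsetSum _ fun j _ => (hint i j).const_mul _, Finset.sum_eq_single i]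
  · rw [integral_const_mul, hsq]; ring
  · intro j _ hj
    rw [integral_const_mul, integral_coord_mul_coord_of_ne f hj.symm, mul_zero]
  · simp

/-- Integral of a quadratic form against the kernel `|z|^{-(N+σ)}` on a ball. -/
lemma setIntegral_bilin_div {N : ℕ} [NeZero N] (δ : ℝ) {σ : ℝ} (hσ : σ < 2)
    (B : E N →L[ℝ] E N →L[ℝ] ℝ) :
    ∫ z in ball (0 : E N) δ, B z z / ‖z‖ ^ ((N : ℝ) + σ) =
      (∑ i, B (EuclideanSpace.single i 1) (EuclideanSpace.single i 1)) / N *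
        ballMoment N δ σ := by
  -- The cut-off puts the ball into the radial weight, so that the integral runs over the whole
  -- space and the rotation argument applies.
  set f : ℝ → ℝ := (Set.Iio δ).indicator fun y => (y ^ ((N : ℝ) + σ))⁻¹ with hf
  have key : ∀ g : E N → ℝ, (fun z => g z * f ‖z‖) =
      (ball (0 : E N) δ).indicator fun z => g z / ‖z‖ ^ ((N : ℝ) + σ) := by
    intro g
    ext z
    by_cases hz : ‖z‖ < δ <;> simp [hf, Set.indicator, hz, div_eq_mul_inv]
  have hint : Integrable fun z : E N => ‖z‖ ^ 2 * f ‖z‖ := by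
    rw [key, integrable_indicator_iff measurableSet_ball]
    exact integrableOn_ballMoment δ hσ
  have h := integral_bilin_mul_radial f hint
    ((by fun_prop : Measurable fun y : ℝ => (y ^ ((N : ℝ) + σ))⁻¹).indicator measurableSet_Iio) B
  rw [key, key, integral_indicator measurableSet_ball, integral_indicator measurableSet_ball] at h
  exact h

/-! ### Tails, and the normalizing constant as `σ → 2`. -/

lemma integrableOn_tail_kernel {N : ℕ} {δ s σ : ℝ} (hδ : 0 < δ) (hs : 0 < s) (hsσ : s ≤ σ)
    (hσ : σ < 2) :
    IntegrableOn (fun z : E N => 1 / ‖z‖ ^ ((N : ℝ) + σ)) (ball 0 δ)ᶜ := by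
  refine Integrable.mono' ((integrable_tail hs).integrableOn.const_mul ((1 + δ⁻¹) ^ ((N : ℝ) + 2)))
    (Measurable.aestronglyMeasurable (by fun_prop)) ?_
  refine (ae_restrict_mem measurableSet_ball.compl).mono fun z hz => ?_
  rw [Real.norm_of_nonneg (by positivity)]
  exact inv_norm_rpow_le hδ hs.le hsσ hσ (by simpa using hz)

/-- Uniform bound for the mass of the kernel outside of a ball. -/
noncomputable def tailMass (N : ℕ) (δ s : ℝ) : ℝ :=
  (1 + δ⁻¹) ^ ((N : ℝ) + 2) * ∫ z : E N, (1 + ‖z‖) ^ (-((N : ℝ) + s))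

lemma tailMass_nonneg {N : ℕ} {δ s : ℝ} (hδ : 0 < δ) : 0 ≤ tailMass N δ s :=
  mul_nonneg (by positivity) (integral_nonneg fun z => by positivity)

lemma setIntegral_tail_kernel_le {N : ℕ} {δ s σ : ℝ} (hδ : 0 < δ) (hs : 0 < s) (hsσ : s ≤ σ)
    (hσ : σ < 2) :
    ∫ z in (ball (0 : E N) δ)ᶜ, 1 / ‖z‖ ^ ((N : ℝ) + σ) ≤ tailMass N δ s := by
  unfold tailMass
  rw [← integral_const_mul]
  calc ∫ z in (ball (0 : E N) δ)ᶜ, 1 / ‖z‖ ^ ((N : ℝ) + σ)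
      ≤ ∫ z in (ball (0 : E N) δ)ᶜ,
        (1 + δ⁻¹) ^ ((N : ℝ) + 2) * (1 + ‖z‖) ^ (-((N : ℝ) + s)) := by
        refine setIntegral_mono_on (integrableOn_tail_kernel hδ hs hsσ hσ)
          ((integrable_tail hs).integrableOn.const_mul _) measurableSet_ball.compl fun z hz => ?_
        exact inv_norm_rpow_le hδ hs.le hsσ hσ (by simpa using hz)
    _ ≤ _ := by
        refine setIntegral_le_integral ((integrable_tail hs).const_mul _)
          (Eventually.of_forall fun z => ?_)
        positivity

lemma integrable_normConst_integrand {N : ℕ} [NeZero N] {σ : ℝ} (hσ0 : 0 < σ) (hσ : σ < 2) :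
    Integrable fun ζ : E N => (1 - Real.cos (ζ 0)) / ‖ζ‖ ^ ((N : ℝ) + σ) := by
  rw [← integrableOn_univ, ← Set.union_compl_self (ball (0 : E N) 1), integrableOn_union]
  constructor
  · refine (integrableOn_ballMoment 1 hσ).mono' (Measurable.aestronglyMeasurable (by fun_prop))
      (Eventually.of_forall fun z => ?_)
    rw [Real.norm_of_nonneg (div_nonneg (by linarith [Real.cos_le_one (z 0)]) (by positivity))]
    gcongr
    have h1 := Real.one_sub_sq_div_two_le_cos (x := z 0)
    have h2 : (z 0) ^ 2 ≤ ‖z‖ ^ 2 := by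
      rw [← sq_abs]
      gcongr
      exact PiLp.norm_apply_le z 0
    nlinarith [sq_nonneg ‖z‖]
  · refine ((integrableOn_tail_kernel one_pos hσ0 le_rfl hσ).const_mul 2).mono'
      (Measurable.aestronglyMeasurable (by fun_prop))
      (Eventually.of_forall fun z => ?_)
    rw [Real.norm_of_nonneg (div_nonneg (by linarith [Real.cos_le_one (z 0)]) (by positivity)),
      mul_one_div]
    gcongr
    linarith [Real.neg_one_le_cos (z 0)]

lemma inv_normConst_le {N : ℕ} [NeZero N] {δ s σ : ℝ} (hδ : 0 < δ) (hs : 0 < s) (hsσ : s ≤ σ)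
    (hσ : σ < 2) :
    (normConst N σ)⁻¹ ≤ ballMoment N δ σ + 2 * tailMass N δ s := by
  have hint := integrable_normConst_integrand (N := N) (hs.trans_le hsσ) hσ
  rw [normConst, inv_inv, ← integral_add_compl (measurableSet_ball (x := (0 : E N)) (ε := δ)) hint]
  gcongr
  · refine setIntegral_mono hint.integrableOn (integrableOn_ballMoment δ hσ) fun z => ?_
    simp only
    gcongr
    have h1 := Real.one_sub_sq_div_two_le_cos (x := z 0)
    have h2 : (z 0) ^ 2 ≤ ‖z‖ ^ 2 := by
      rw [← sq_abs]
      gcongr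
      exact PiLp.norm_apply_le z 0
    nlinarith [sq_nonneg ‖z‖]
  · refine le_trans ?_ (mul_le_mul_of_nonneg_left (setIntegral_tail_kernel_le hδ hs hsσ hσ)
      zero_le_two)
    rw [← integral_const_mul]
    refine setIntegral_mono hint.integrableOn
      ((integrableOn_tail_kernel hδ hs hsσ hσ).const_mul 2) fun z => ?_
    simp only [mul_one_div]
    gcongr
    linarith [Real.neg_one_le_cos (z 0)]

lemma le_inv_normConst {N : ℕ} [NeZero N] {δ σ : ℝ} (hδ1 : δ ≤ 1) (hσ0 : 0 < σ)
    (hσ : σ < 2) :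
    2 / Real.pi ^ 2 / N * ballMoment N δ σ ≤ (normConst N σ)⁻¹ := by
  have hint := integrable_normConst_integrand (N := N) hσ0 hσ
  -- The form `z ↦ z₀²` has trace one, so its integral over the ball is exactly the moment divided
  -- by `N`.
  set B : E N →L[ℝ] E N →L[ℝ] ℝ :=
    (EuclideanSpace.proj 0 : E N →L[ℝ] ℝ).smulRight (EuclideanSpace.proj 0 : E N →L[ℝ] ℝ) with hB
  have hBz : ∀ z : E N, B z z = (z 0) ^ 2 := fun z => by simp [hB, pow_two]
  have h := setIntegral_bilin_div δ hσ B
  have hsum : ∑ i, B (EuclideanSpace.single i 1) (EuclideanSpace.single i 1) = 1 := by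
    rw [Finset.sum_eq_single 0]
    · simp [hBz]
    · intro b _ hb
      simp [hBz, hb.symm]
    · simp
  rw [hsum] at h
  have h2 : 2 / Real.pi ^ 2 / N * ballMoment N δ σ =
      ∫ z in ball (0 : E N) δ, 2 / Real.pi ^ 2 * (B z z / ‖z‖ ^ ((N : ℝ) + σ)) := by
    rw [integral_const_mul, h]; ring
  rw [h2, normConst, inv_inv]
  have hint2 : IntegrableOn (fun z : E N => B z z / ‖z‖ ^ ((N : ℝ) + σ)) (ball 0 δ) := by
    refine (integrableOn_ballMoment δ hσ).mono' (Measurable.aestronglyMeasurable (by fun_prop))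
      (Eventually.of_forall fun z => ?_)
    rw [hBz, Real.norm_of_nonneg (by positivity)]
    gcongr ?_ / _
    rw [← sq_abs]
    gcongr
    exact PiLp.norm_apply_le z 0
  refine (setIntegral_mono_on (hint2.const_mul _) hint.integrableOn measurableSet_ball
    fun z hz => ?_).trans (setIntegral_le_integral hint (Eventually.of_forall fun z =>
      div_nonneg (by linarith [Real.cos_le_one (z 0)]) (by positivity)))
  rw [hBz, ← mul_div_assoc]
  gcongr
  have : |z 0| ≤ Real.pi := by
    have h1 := PiLp.norm_apply_le z 0
    rw [Real.norm_eq_abs] at h1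
    rw [mem_ball_zero_iff] at hz
    linarith [Real.pi_gt_three]
  -- The bound `1 - cos t ≥ 2t²/π²` holds for `|t| ≤ π`.
  linarith [Real.cos_le_one_sub_mul_cos_sq this]

/-- For `σ` close to `2`, `C_{N,σ}` is small, while `C_{N,σ} ∫_{B_δ} |z|^{2-N-σ} dz` is not. -/
lemma exists_normConst_bounds (N : ℕ) [NeZero N] {δ τ s : ℝ} (hδ : 0 < δ) (hδ1 : δ ≤ 1)
    (hτ : 0 < τ) (hs : s < 2) :
    ∃ σ₀ ∈ Set.Ioo s 2, ∀ σ ∈ Set.Ioo σ₀ 2, 0 < normConst N σ ∧ normConst N σ ≤ τ ∧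
      1 / 2 ≤ normConst N σ * ballMoment N δ σ := by
  have hN : 0 < (N : ℝ) := by exact_mod_cast NeZero.pos N
  have hv := volume_real_unitBall_pos (N := N)
  set b : ℝ := N * volume.real (ball (0 : E N) 1) * δ with hb
  have hb0 : 0 < b := by positivity
  set c : ℝ := 2 / Real.pi ^ 2 / N with hc
  have hc0 : 0 < c := by positivity
  -- A moment above `T` makes the inverse constant exceed `τ⁻¹` and absorbs the tail, giving `C⁻¹ ≤
  -- 2J`, that is `CJ ≥ 1/2`.
  set T : ℝ := max 1 (max (2 * tailMass N δ 1) (c⁻¹ * τ⁻¹)) with hT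
  have hT0 : 0 < T := lt_of_lt_of_le one_pos (le_max_left _ _)
  -- For `σ > 2 - b / T` the lower bound `b / (2 - σ)` of the moment exceeds `T`.
  refine ⟨max (max 1 ((s + 2) / 2)) (2 - b / T), ⟨?_, ?_⟩, fun σ hσ => ?_⟩
  · exact lt_of_lt_of_le (by linarith) ((le_max_right _ _).trans (le_max_left _ _))
  · simp only [max_lt_iff]
    refine ⟨⟨by norm_num, by linarith⟩, ?_⟩
    have : 0 < b / T := by positivity
    linarith
  obtain ⟨h1, h2⟩ := hσ
  simp only [max_lt_iff] at h1
  have hσ2 : 0 < 2 - σ := by linarith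
  have hJT : T ≤ ballMoment N δ σ := by
    refine le_trans ?_ (le_ballMoment hδ hδ1 h1.1.1.le h2)
    rw [← hb, ← div_eq_mul_inv, le_div_iff₀ hσ2]
    have : 2 - σ < b / T := by linarith
    rw [lt_div_iff₀ hT0] at this
    linarith
  have hlow := le_inv_normConst (N := N) hδ1 (by linarith) h2
  have hup := inv_normConst_le (N := N) hδ one_pos h1.1.1.le h2
  rw [← hc] at hlow
  have hJ := hT0.trans_le hJT
  have hC0 : 0 < (normConst N σ)⁻¹ := lt_of_lt_of_le (by positivity) hlow
  have hC : 0 < normConst N σ := inv_pos.mp hC0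
  refine ⟨hC, ?_, ?_⟩
  · rw [← inv_le_inv₀ hτ hC]
    have h3 : c⁻¹ * τ⁻¹ ≤ T := (le_max_right _ _).trans (le_max_right _ _)
    calc τ⁻¹ = c * (c⁻¹ * τ⁻¹) := by field_simp
      _ ≤ c * ballMoment N δ σ := by gcongr; exact h3.trans hJT
      _ ≤ _ := hlow
  · have h3 : 2 * tailMass N δ 1 ≤ T := (le_max_left _ _).trans (le_max_right _ _)
    have h4 : (normConst N σ)⁻¹ ≤ 2 * ballMoment N δ σ := by linarith
    calc (1 : ℝ) / 2 = normConst N σ * (normConst N σ)⁻¹ / 2 := by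
          rw [mul_inv_cancel₀ hC.ne']
      _ ≤ normConst N σ * (2 * ballMoment N δ σ) / 2 := by gcongr
      _ = _ := by ring

/-! ### Second differences of test functions. -/

lemma laplacian_eq_sum {N : ℕ} (φ : E N → ℝ) (x : E N) :
    Laplacian.laplacian φ x = ∑ i, fderiv ℝ (fderiv ℝ φ) x (EuclideanSpace.single i 1)
      (EuclideanSpace.single i 1) := by
  rw [InnerProductSpace.laplacian_eq_iteratedFDeriv_orthonormalBasis φ
    (EuclideanSpace.basisFun (Fin N) ℝ)]
  simp [iteratedFDeriv_two_apply]

/-- Second-order symmetric Taylor estimate, uniform in the base point. -/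
lemma exists_second_difference_bound {N : ℕ} {φ : E N → ℝ} (hφ : ContDiff ℝ 2 φ) (x₀ : E N)
    {ε : ℝ} (hε : 0 < ε) :
    ∃ δ > 0, ∀ x ∈ ball x₀ δ, ∀ z ∈ ball (0 : E N) δ,
      |φ (x + z) + φ (x - z) - 2 * φ x - fderiv ℝ (fderiv ℝ φ) x₀ z z| ≤ ε * ‖z‖ ^ 2 := by
  have hφ1 : ContDiff ℝ 1 (fderiv ℝ φ) := hφ.fderiv_right (by norm_num)
  -- Strict differentiability compares `Dφ` at two arbitrary points near `x₀`, here `x ± s • z`;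
  -- this is the source of uniformity in `x`. The estimate is then integrated in `s` by the mean
  -- value inequality.
  have hst := (hφ1.contDiffAt (x := x₀)).hasStrictFDerivAt (by norm_num)
  have hev := hst.isLittleO.def (half_pos hε)
  obtain ⟨ρ, hρ, hball⟩ := Metric.eventually_nhds_iff_ball.mp hev
  set B := fderiv ℝ (fderiv ℝ φ) x₀
  refine ⟨ρ / 2, by positivity, fun x hx z hz => ?_⟩
  rw [mem_ball_zero_iff] at hz
  rw [mem_ball] at hx
  have hmem : ∀ s ∈ Set.Icc (0 : ℝ) 1, (x + s • z, x - s • z) ∈ ball (x₀, x₀) ρ := by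
    intro s hs
    have hsz : ‖s • z‖ < ρ / 2 := by
      rw [norm_smul, Real.norm_of_nonneg hs.1]
      nlinarith [hs.2, norm_nonneg z]
    rw [mem_ball, Prod.dist_eq, max_lt_iff]
    constructor
    · calc dist (x + s • z) x₀ ≤ dist (x + s • z) x + dist x x₀ := dist_triangle _ _ _
        _ < ρ := by rw [dist_self_add_left]; linarith
    · calc dist (x - s • z) x₀ ≤ dist (x - s • z) x + dist x x₀ := dist_triangle _ _ _
        _ < ρ := by rw [dist_self_sub_left]; linarith
  have hder : ∀ s : ℝ, HasDerivAt (fun s : ℝ => φ (x + s • z) + φ (x - s • z) - s ^ 2 * B z z)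
      (fderiv ℝ φ (x + s • z) z - fderiv ℝ φ (x - s • z) z - 2 * s * B z z) s := by
    intro s
    have hd : ∀ y, HasFDerivAt φ (fderiv ℝ φ y) y := fun y =>
      (hφ.differentiable (by norm_num) y).hasFDerivAt
    have h1 : HasDerivAt (fun s : ℝ => x + s • z) z s := by
      simpa using ((hasDerivAt_id s).smul_const z).const_add x
    have h2 : HasDerivAt (fun s : ℝ => x - s • z) (-z) s := by
      simpa using ((hasDerivAt_id s).smul_const z).const_sub x
    have h3 := ((hd _).comp_hasDerivAt s h1).add ((hd _).comp_hasDerivAt s h2)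
    have h4 := h3.sub ((hasDerivAt_pow 2 s).mul_const (B z z))
    convert! h4 using 1
    simp [sub_eq_add_neg]
  have hbound := norm_image_sub_le_of_norm_deriv_le_segment_01' (C := ε / 2 * (2 * ‖z‖ ^ 2))
    (fun s _ => (hder s).hasDerivWithinAt) (fun s hs => by
      have h := hball _ (hmem s ⟨hs.1, hs.2.le⟩)
      have hsub : x + s • z - (x - s • z) = (2 * s) • z := by module
      simp only [hsub] at h
      have h2 := ContinuousLinearMap.le_of_opNorm_le _ h z
      have e : (fderiv ℝ φ (x + s • z) - fderiv ℝ φ (x - s • z) - B ((2 * s) • z)) z =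
          fderiv ℝ φ (x + s • z) z - fderiv ℝ φ (x - s • z) z - 2 * s * B z z := by
        simp
      rw [e] at h2
      refine h2.trans ?_
      rw [norm_smul, Real.norm_of_nonneg (by linarith [hs.1])]
      have : s * ‖z‖ ^ 2 ≤ ‖z‖ ^ 2 := mul_le_of_le_one_left (by positivity) hs.2.le
      calc ε / 2 * (2 * s * ‖z‖) * ‖z‖ = ε / 2 * (2 * (s * ‖z‖ ^ 2)) := by ring
        _ ≤ _ := by gcongr)
  rw [Real.norm_eq_abs] at hbound
  convert! hbound using 1
  · congr 1
    simp only [one_smul, zero_smul, add_zero, sub_zero]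
    ring
  · ring

/-! ### Near and far parts of the linear operators. -/

lemma IsEllipticKernel.nonneg {N : ℕ} [NeZero N] {lam Lam σ : ℝ} {K : E N → ℝ}
    (hK : IsEllipticKernel lam Lam σ K) (hlam : 0 ≤ lam) (hC : 0 ≤ normConst N σ) {z : E N}
    (hz : z ≠ 0) : 0 ≤ K z :=
  le_trans (by positivity) (hK.lower z hz)

/-- On a ball, the principal value is an absolutely convergent integral of second differences. -/
lemma linOp_ball_eq {N : ℕ} [NeZero N] {lam Lam σ : ℝ} {K : E N → ℝ}
    (hK : IsEllipticKernel lam Lam σ K) (hlam : 0 ≤ lam) (hLam : 0 ≤ Lam) (hσ0 : 0 < σ)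
    (hσ : σ < 2) (hC : 0 ≤ normConst N σ) {φ : E N → ℝ} (hφ : Continuous φ) {x : E N} {δ A : ℝ}
    (hA : ∀ z ∈ ball (0 : E N) δ, |φ (x + z) + φ (x - z) - 2 * φ x| ≤ A * ‖z‖ ^ 2) :
    IntegrableOn (fun z => (φ (x + z) + φ (x - z) - 2 * φ x) * K z) (ball 0 δ) ∧
    linOp K (ball 0 δ) φ x =
      1 / 2 * ∫ z in ball 0 δ, (φ (x + z) + φ (x - z) - 2 * φ x) * K z := by
  set S : E N → ℝ := fun z => φ (x + z) + φ (x - z) - 2 * φ x with hS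
  have hmeas : Measurable fun z => S z * K z := (by fun_prop : Measurable S).mul hK.measurable
  have hint : IntegrableOn (fun z => S z * K z) (ball 0 δ) := by
    refine ((integrableOn_ballMoment δ hσ).const_mul (A * (Lam * normConst N σ))).mono'
      hmeas.aestronglyMeasurable ?_
    refine (ae_restrict_mem measurableSet_ball).mono fun z hz => ?_
    rcases eq_or_ne z 0 with rfl | hz0
    · have : S 0 = 0 := by simp only [hS, add_zero, sub_zero]; ring
      simp [this]
    rw [norm_mul, Real.norm_eq_abs, Real.norm_of_nonneg (hK.nonneg hlam hC hz0)]
    calc |S z| * K z ≤ (A * ‖z‖ ^ 2) * (Lam * (normConst N σ / ‖z‖ ^ ((N : ℝ) + σ))) :=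
          mul_le_mul (hA z hz) (hK.upper z hz0) (hK.nonneg hlam hC hz0)
            ((abs_nonneg _).trans (hA z hz))
      _ = _ := by ring
  refine ⟨hint, ?_⟩
  -- On an annulus everything is integrable, so `z ↦ -z` replaces the first difference by half the
  -- second difference, which is `O(‖z‖²)` and integrable against `K` down to the origin.
  have hann : ∀ r > 0, ∫ z in ball (0 : E N) δ \ ball 0 r, (φ (x + z) - φ x) * K z =
      1 / 2 * ∫ z in ball (0 : E N) δ \ ball 0 r, S z * K z := by
    intro r hr
    set D : Set (E N) := ball (0 : E N) δ \ ball 0 r with hD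
    have hDm : MeasurableSet D := measurableSet_ball.diff measurableSet_ball
    have hDint : IntegrableOn (fun z => (φ (x + z) - φ x) * K z) D := by
      obtain ⟨G, hG⟩ := (isCompact_closedBall (0 : E N) δ).exists_bound_of_continuousOn
        (f := fun z => φ (x + z) - φ x) (by fun_prop)
      refine Measure.integrableOn_of_bounded (M := G * (Lam * (normConst N σ / r ^ ((N : ℝ) + σ))))
        ((measure_mono Set.sdiff_subset).trans_lt measure_ball_lt_top).ne
        (((by fun_prop : Measurable fun z => φ (x + z) - φ x).mul
          hK.measurable).aestronglyMeasurable) ?_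
      refine (ae_restrict_mem hDm).mono fun z hz => ?_
      have hzr : r ≤ ‖z‖ := by simpa using hz.2
      have hz0 : z ≠ 0 := norm_pos_iff.mp (hr.trans_le hzr)
      rw [norm_mul, Real.norm_of_nonneg (hK.nonneg hlam hC hz0)]
      have hGz := hG z (ball_subset_closedBall hz.1)
      refine mul_le_mul hGz ((hK.upper z hz0).trans ?_) (hK.nonneg hlam hC hz0)
        ((norm_nonneg _).trans hGz)
      gcongr
    have hDneg : ∀ z, -z ∈ D ↔ z ∈ D := fun z => by simp [hD]
    have hD0 : ∀ z ∈ D, z ≠ 0 := by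
      rintro z hz rfl
      exact hz.2 (mem_ball_self hr)
    have hindneg : (fun z => D.indicator (fun z => (φ (x + z) - φ x) * K z) (-z)) =
        D.indicator (fun z => (φ (x - z) - φ x) * K z) := by
      ext z
      by_cases hz : z ∈ D
      · rw [Set.indicator_of_mem ((hDneg z).mpr hz), Set.indicator_of_mem hz, hK.symm z (hD0 z hz),
          sub_eq_add_neg x z]
      · rw [Set.indicator_of_notMem (mt (hDneg z).mp hz), Set.indicator_of_notMem hz]
    have hDint' : IntegrableOn (fun z => (φ (x - z) - φ x) * K z) D := by
      rw [← integrable_indicator_iff hDm, ← hindneg]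
      exact ((integrable_indicator_iff hDm).mpr hDint).comp_neg
    have heq : ∫ z in D, (φ (x - z) - φ x) * K z = ∫ z in D, (φ (x + z) - φ x) * K z := by
      rw [← integral_indicator hDm, ← hindneg, integral_neg_eq_self
        (D.indicator fun z => (φ (x + z) - φ x) * K z), integral_indicator hDm]
    have hsum : ∫ z in D, S z * K z =
        ∫ z in D, (φ (x + z) - φ x) * K z + (φ (x - z) - φ x) * K z := by
      refine integral_congr_ae (Eventually.of_forall fun z => ?_)
      simp only [hS]; ring
    rw [hsum, integral_add hDint hDint', heq]
    ring
  refine Tendsto.limUnder_eq ?_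
  have hlim : Tendsto (fun r => 1 / 2 * ∫ z in ball (0 : E N) δ \ ball 0 r, S z * K z)
      (𝓝[>] (0 : ℝ)) (𝓝 (1 / 2 * ∫ z in ball (0 : E N) δ, S z * K z)) := by
    refine Tendsto.const_mul _ ?_
    have hset : ∀ r : ℝ, ∫ z in ball (0 : E N) δ \ ball 0 r, S z * K z =
        ∫ z in ball (0 : E N) δ, (ball (0 : E N) r)ᶜ.indicator (fun z => S z * K z) z := by
      intro r
      rw [setIntegral_indicator measurableSet_ball.compl, Set.sdiff_eq]
    simp_rw [hset]
    refine tendsto_integral_filter_of_dominated_convergence (fun z => ‖S z * K z‖)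
      (Eventually.of_forall fun r =>
        (hmeas.indicator measurableSet_ball.compl).aestronglyMeasurable)
      (Eventually.of_forall fun r => Eventually.of_forall fun z => norm_indicator_le_norm_self _ _)
      hint.norm (Eventually.of_forall fun z => ?_)
    rcases eq_or_ne z 0 with rfl | hz0
    · have : S 0 * K 0 = 0 := by
        have : S 0 = 0 := by simp only [hS, add_zero, sub_zero]; ring
        rw [this, zero_mul]
      refine tendsto_const_nhds.congr fun r => ?_
      simp [Set.indicator, this]
    · refine tendsto_const_nhds.congr' ?_
      have : ∀ᶠ r in 𝓝[>] (0 : ℝ), r < ‖z‖ :=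
        mem_nhdsWithin_of_mem_nhds (Iio_mem_nhds (norm_pos_iff.mpr hz0))
      filter_upwards [this] with r hr
      rw [Set.indicator_of_mem]
      simpa using hr.le
  refine hlim.congr' ?_
  filter_upwards [self_mem_nhdsWithin] with r hr
  exact (hann r hr).symm

/-- The quadratic part of `φ` against the frozen kernel `k C / |z|^{N+σ}` integrates exactly. What
remains is the Taylor remainder against `K` and the quadratic form against the deviation of `K` from
that kernel. -/
lemma linOp_ball_sub_le {N : ℕ} [NeZero N] {lam Lam σ : ℝ} {K : E N → ℝ}
    (hK : IsEllipticKernel lam Lam σ K) (hlam : 0 ≤ lam) (hLam : 0 ≤ Lam) (hσ0 : 0 < σ)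
    (hσ : σ < 2) (hC : 0 < normConst N σ) {φ : E N → ℝ} (hφ : Continuous φ) {x : E N}
    {δ ε k : ℝ} (B : E N →L[ℝ] E N →L[ℝ] ℝ)
    (hA : ∀ z ∈ ball (0 : E N) δ, |φ (x + z) + φ (x - z) - 2 * φ x - B z z| ≤ ε * ‖z‖ ^ 2)
    (hk : ∀ z ∈ ball (0 : E N) δ, z ≠ 0 →
      |K z * ‖z‖ ^ ((N : ℝ) + σ) / normConst N σ - k| ≤ ε) :
    |linOp K (ball 0 δ) φ x - 1 / 2 * (normConst N σ * ballMoment N δ σ) * (k *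
      ((∑ i, B (EuclideanSpace.single i 1) (EuclideanSpace.single i 1)) / N))| ≤
      1 / 2 * (normConst N σ * ballMoment N δ σ) * (ε * (Lam + ‖B‖)) := by
  set C := normConst N σ
  have hBz : ∀ z : E N, |B z z| ≤ ‖B‖ * ‖z‖ ^ 2 := fun z => by
    have := B.le_opNorm₂ z z
    rw [Real.norm_eq_abs] at this
    linarith
  obtain ⟨hint, heq⟩ := linOp_ball_eq hK hlam hLam hσ0 hσ hC.le hφ (x := x) (δ := δ)
    (A := ε + ‖B‖) (fun z hz => by
      have h1 := hA z hz
      have h2 := hBz z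
      rw [abs_le] at *
      constructor <;> linarith [h1.1, h1.2, h2.1, h2.2])
  have hBint : IntegrableOn (fun z : E N => B z z / ‖z‖ ^ ((N : ℝ) + σ)) (ball 0 δ) := by
    refine ((integrableOn_ballMoment δ hσ).const_mul ‖B‖).mono'
      (Measurable.aestronglyMeasurable (by fun_prop)) (Eventually.of_forall fun z => ?_)
    rw [norm_div, Real.norm_of_nonneg (by positivity : 0 ≤ ‖z‖ ^ ((N : ℝ) + σ)), ← mul_div_assoc]
    gcongr
    exact hBz z
  have hrw : 1 / 2 * (C * ballMoment N δ σ) * (k *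
      ((∑ i, B (EuclideanSpace.single i 1) (EuclideanSpace.single i 1)) / N)) =
      1 / 2 * ∫ z in ball (0 : E N) δ, C * k * (B z z / ‖z‖ ^ ((N : ℝ) + σ)) := by
    rw [integral_const_mul, setIntegral_bilin_div δ hσ B]; ring
  have hrw2 : 1 / 2 * (C * ballMoment N δ σ) * (ε * (Lam + ‖B‖)) =
      1 / 2 * ∫ z in ball (0 : E N) δ,
        C * (ε * (Lam + ‖B‖)) * (‖z‖ ^ 2 / ‖z‖ ^ ((N : ℝ) + σ)) := by
    rw [integral_const_mul, ballMoment]; ring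
  rw [heq, hrw, hrw2, ← mul_sub, ← integral_sub hint (hBint.const_mul _), abs_mul,
    abs_of_pos (by norm_num : (0 : ℝ) < 1 / 2)]
  refine mul_le_mul_of_nonneg_left ?_ (by norm_num)
  rw [← Real.norm_eq_abs]
  refine norm_integral_le_of_norm_le ((integrableOn_ballMoment δ hσ).const_mul _) ?_
  refine (ae_restrict_mem measurableSet_ball).mono fun z hz => ?_
  rcases eq_or_ne z 0 with rfl | hz0
  · have : φ x + φ x - 2 * φ x = 0 := by ring
    simp [this]
  have hpos : 0 < ‖z‖ ^ ((N : ℝ) + σ) := Real.rpow_pos_of_pos (norm_pos_iff.mpr hz0) _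
  set g := ‖z‖ ^ ((N : ℝ) + σ)
  have hK0 := hK.nonneg hlam hC.le hz0
  have hKu := hK.upper z hz0
  have hsplit : (φ (x + z) + φ (x - z) - 2 * φ x) * K z - C * k * (B z z / g) =
      (φ (x + z) + φ (x - z) - 2 * φ x - B z z) * K z + B z z * (C / g) * (K z * g / C - k) := by
    have : C / g * (K z * g / C) = K z := by field_simp
    linear_combination (-B z z) * this
  rw [hsplit, Real.norm_eq_abs]
  refine (abs_add_le _ _).trans ?_
  rw [abs_mul, abs_mul, abs_mul, abs_of_nonneg hK0, abs_of_pos (div_pos hC hpos)]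
  have hε : 0 ≤ ε := (abs_nonneg _).trans (hk z hz hz0)
  calc |φ (x + z) + φ (x - z) - 2 * φ x - B z z| * K z + |B z z| * (C / g) * |K z * g / C - k|
      ≤ ε * ‖z‖ ^ 2 * (Lam * (C / g)) + ‖B‖ * ‖z‖ ^ 2 * (C / g) * ε := by
        gcongr
        · exact hA z hz
        · exact hBz z
        · exact hk z hz hz0
    _ = _ := by ring

/-- Growth of order `1 + α` against decay `N + s` leaves an integrable decay `N + β` with `β = s -
(1 + α) > 0`. The factor `normConst N σ` makes the far part vanish as `σ → 2`. -/
lemma linOp_compl_ball_le {N : ℕ} [NeZero N] {lam Lam σ s M α : ℝ} {K : E N → ℝ}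
    (hK : IsEllipticKernel lam Lam σ K) (hlam : 0 ≤ lam) (hLam : 0 ≤ Lam) (hα : 0 ≤ α)
    (hs : 1 + α < s) (hsσ : s ≤ σ) (hσ : σ < 2) (hC : 0 ≤ normConst N σ) {u : E N → ℝ}
    (hM : 0 ≤ M) (hu : ∀ x, |u x| ≤ M * (1 + ‖x‖ ^ (1 + α))) {x : E N} (hx : ‖x‖ ≤ 1) {δ : ℝ}
    (hδ : 0 < δ) :
    |linOp K (ball 0 δ)ᶜ u x| ≤
      normConst N σ * (Lam * (4 * M) * tailMass N δ (s - (1 + α))) := by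
  set C := normConst N σ
  have heq : linOp K (ball 0 δ)ᶜ u x = ∫ z in (ball (0 : E N) δ)ᶜ, (u (x + z) - u x) * K z := by
    refine Tendsto.limUnder_eq (tendsto_const_nhds.congr' ?_)
    have : ∀ᶠ r in 𝓝[>] (0 : ℝ), r < δ := mem_nhdsWithin_of_mem_nhds (Iio_mem_nhds hδ)
    filter_upwards [this] with r hr
    have hset : (ball (0 : E N) δ)ᶜ \ ball 0 r = (ball 0 δ)ᶜ := by
      rw [Set.sdiff_eq, ← Set.compl_union, Set.union_eq_left.mpr (ball_subset_ball hr.le)]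
    rw [hset]
  set β := s - (1 + α)
  have hβ : 0 < β := by simp only [β]; linarith
  rw [heq, ← Real.norm_eq_abs]
  have hint := (integrable_tail (N := N) hβ).const_mul
    (C * (Lam * (4 * M) * (1 + δ⁻¹) ^ ((N : ℝ) + 2)))
  have hpt : ∀ z ∈ (ball (0 : E N) δ)ᶜ, ‖(u (x + z) - u x) * K z‖ ≤
      C * (Lam * (4 * M) * (1 + δ⁻¹) ^ ((N : ℝ) + 2)) * (1 + ‖z‖) ^ (-((N : ℝ) + β)) := by
    intro z hz
    have hzδ : δ ≤ ‖z‖ := by simpa using hz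
    have hz0 : z ≠ 0 := norm_pos_iff.mp (hδ.trans_le hzδ)
    have hK0 := hK.nonneg hlam hC hz0
    have hg := inv_norm_rpow_le (N := N) hδ (by linarith) hsσ hσ hzδ
    have hone : 1 ≤ (1 + ‖z‖) ^ (1 + α) :=
      Real.one_le_rpow (by linarith [norm_nonneg z]) (by linarith)
    have h1 : ‖x + z‖ ^ (1 + α) ≤ (1 + ‖z‖) ^ (1 + α) :=
      Real.rpow_le_rpow (norm_nonneg _) ((norm_add_le x z).trans (by linarith)) (by linarith)
    have h2 : ‖x‖ ^ (1 + α) ≤ 1 := Real.rpow_le_one (norm_nonneg _) hx (by linarith)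
    have hub : |u (x + z) - u x| ≤ 4 * M * (1 + ‖z‖) ^ (1 + α) := by
      calc |u (x + z) - u x| ≤ |u (x + z)| + |u x| := abs_sub _ _
        _ ≤ M * (1 + ‖x + z‖ ^ (1 + α)) + M * (1 + ‖x‖ ^ (1 + α)) := add_le_add (hu _) (hu _)
        _ ≤ M * (1 + (1 + ‖z‖) ^ (1 + α)) + M * (1 + 1) := by gcongr
        _ ≤ _ := by nlinarith
    rw [norm_mul, Real.norm_eq_abs, Real.norm_of_nonneg hK0]
    calc |u (x + z) - u x| * K z
        ≤ (4 * M * (1 + ‖z‖) ^ (1 + α)) * (Lam * (C * (1 / ‖z‖ ^ ((N : ℝ) + σ)))) := by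
          gcongr
          rw [mul_one_div]
          exact hK.upper z hz0
      _ ≤ (4 * M * (1 + ‖z‖) ^ (1 + α)) *
          (Lam * (C * ((1 + δ⁻¹) ^ ((N : ℝ) + 2) * (1 + ‖z‖) ^ (-((N : ℝ) + s))))) := by
          gcongr
      _ = C * (Lam * (4 * M) * (1 + δ⁻¹) ^ ((N : ℝ) + 2)) *
          ((1 + ‖z‖) ^ (1 + α) * (1 + ‖z‖) ^ (-((N : ℝ) + s))) := by ring
      _ = _ := by
          rw [← Real.rpow_add (by positivity)]
          congr 2
          simp only [β]; ring
  calc ‖∫ z in (ball (0 : E N) δ)ᶜ, (u (x + z) - u x) * K z‖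
      ≤ ∫ z in (ball (0 : E N) δ)ᶜ, C * (Lam * (4 * M) * (1 + δ⁻¹) ^ ((N : ℝ) + 2)) *
        (1 + ‖z‖) ^ (-((N : ℝ) + β)) :=
        norm_integral_le_of_norm_le hint.integrableOn
          ((ae_restrict_mem measurableSet_ball.compl).mono hpt)
    _ ≤ ∫ z, C * (Lam * (4 * M) * (1 + δ⁻¹) ^ ((N : ℝ) + 2)) *
        (1 + ‖z‖) ^ (-((N : ℝ) + β)) :=
        setIntegral_le_integral hint (Eventually.of_forall fun z => by positivity)
    _ = _ := by rw [integral_const_mul, tailMass]; ring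

/-! ### Almost solutions tested where `Δφ ≠ 0`. -/

/-- The standing assumptions on the kernels, on `p` and on the almost solution `u`. -/
structure IsAlmostSolution {N : ℕ} [NeZero N] {ι κ : Type*} (γ lam Lam M α : ℝ) (ω : ℝ≥0 → ℝ≥0)
    (η σ : ℝ) (K : ι → κ → E N → ℝ) (k : ι → κ → ℝ) (p : E N) (u : E N → ℝ) : Prop where
  elliptic : ∀ i j, IsEllipticKernel lam Lam σ (K i j)
  mem_Icc : ∀ i j, k i j ∈ Set.Icc lam Lam
  close : ∀ i j, ∀ z : E N, z ≠ 0 → ‖z‖ ≤ 1 →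
    |K i j z * ‖z‖ ^ ((N : ℝ) + σ) / normConst N σ - k i j| ≤ ω ‖z‖₊
  sub : IsNonlocalSubsolution γ p K (fun _ => η) u
  super : IsNonlocalSupersolution γ p K (fun _ => -η) u
  modulus : ∀ x ∈ closedBall (0 : E N) 1, ∀ y ∈ closedBall (0 : E N) 1,
    |u x - u y| ≤ ω ‖x - y‖₊
  growth : ∀ x, |u x| ≤ M * (1 + ‖x‖ ^ (1 + α))

/-- If `Δφ(x₀) ≠ 0`, the linear operators with `σ` close to `2` have the sign of `Δφ(x₀)` when
evaluated on `φ` near `x₀`, with far part given by a function of controlled growth. -/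
lemma exists_linOp_estimate {N : ℕ} [NeZero N] {lam Lam M α : ℝ} {ω : ℝ≥0 → ℝ≥0}
    (hlam : 0 < lam) (hLam : lam ≤ Lam) (hM : 0 < M) (hα : α ∈ Set.Ioo (0 : ℝ) 1)
    (hω : Tendsto ω (𝓝 0) (𝓝 0)) {φ : E N → ℝ} (hφ : ContDiff ℝ 2 φ) {x₀ : E N}
    (hL : Laplacian.laplacian φ x₀ ≠ 0) {r : ℝ} (hr : 0 < r) :
    ∃ δ ∈ Set.Ioo 0 r, ∃ σ₀ ∈ Set.Ioo (1 + α) 2, ∀ σ ∈ Set.Ioo σ₀ 2,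
      ∃ a : ℝ, 1 / (4 * N) ≤ a ∧ ∀ (K : E N → ℝ) (k : ℝ), IsEllipticKernel lam Lam σ K →
      (∀ z : E N, z ≠ 0 → ‖z‖ ≤ 1 →
        |K z * ‖z‖ ^ ((N : ℝ) + σ) / normConst N σ - k| ≤ ω ‖z‖₊) →
      ∀ u : E N → ℝ, (∀ x, |u x| ≤ M * (1 + ‖x‖ ^ (1 + α))) →
      ∀ x ∈ ball x₀ δ, ‖x‖ ≤ 1 →
        |linOp K (ball 0 δ) φ x + linOp K (ball 0 δ)ᶜ u x -
          a * (k * Laplacian.laplacian φ x₀)| ≤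
          a * (lam * |Laplacian.laplacian φ x₀| / 2) := by
  set L := Laplacian.laplacian φ x₀ with hLdef
  set B := fderiv ℝ (fderiv ℝ φ) x₀ with hB
  have hN : 0 < (N : ℝ) := by exact_mod_cast NeZero.pos N
  have hLp : 0 < |L| := abs_pos.mpr hL
  have hLam0 : 0 < Lam := hlam.trans_le hLam
  have hD : 0 < Lam + ‖B‖ := by positivity
  -- Chosen so that the near error is `a * (lam * |L| / 4)`, half of the admissible error.
  set ε : ℝ := lam * |L| / (4 * N * (Lam + ‖B‖)) with hε
  have hε0 : 0 < ε := by positivity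
  obtain ⟨δ₁, hδ₁, hT⟩ := exists_second_difference_bound hφ x₀ hε0
  obtain ⟨δ₂, hδ₂, hω2⟩ : ∃ δ₂ > 0, ∀ z : E N, ‖z‖ < δ₂ → (ω ‖z‖₊ : ℝ) ≤ ε := by
    have h := hω.eventually (eventually_le_nhds (show (0 : ℝ≥0) < ⟨ε, hε0.le⟩ from hε0))
    obtain ⟨δ₂, hδ₂, h2⟩ := Metric.eventually_nhds_iff.mp h
    exact ⟨δ₂, hδ₂, fun z hz => h2 (by simpa [NNReal.dist_eq] using hz)⟩
  set δ : ℝ := min (min δ₁ δ₂) (min (r / 2) 1) with hδdef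
  have hδ : 0 < δ := by positivity
  have hδ1 : δ ≤ δ₁ := (min_le_left _ _).trans (min_le_left _ _)
  have hδ2 : δ ≤ δ₂ := (min_le_left _ _).trans (min_le_right _ _)
  have hδr : δ ≤ r / 2 := (min_le_right _ _).trans (min_le_left _ _)
  have hδone : δ ≤ 1 := (min_le_right _ _).trans (min_le_right _ _)
  -- The midpoint of `1 + α` and `2`.
  set s : ℝ := (3 + α) / 2 with hs
  set F : ℝ := Lam * (4 * M) * tailMass N δ (s - (1 + α)) with hF
  have hF0 : 0 ≤ F := mul_nonneg (by positivity) (tailMass_nonneg hδ)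
  -- With this `τ` the far part is at most `lam * |L| / (16 * N)`, which `a ≥ 1/(4N)` bounds by the
  -- other half of the admissible error.
  obtain ⟨σ₀, hσ₀, hCσ⟩ := exists_normConst_bounds N hδ hδone
    (τ := lam * |L| / (16 * N * (F + 1))) (by positivity) (s := s) (by linarith [hα.2])
  refine ⟨δ, ⟨hδ, by linarith⟩, σ₀, ⟨by linarith [hσ₀.1, hα.2], hσ₀.2⟩, fun σ hσ => ?_⟩
  obtain ⟨hC, hCτ, hCJ⟩ := hCσ σ hσ
  set C := normConst N σ
  set J := ballMoment N δ σ
  refine ⟨1 / 2 * (C * J) / N, ?_, fun K k hK hk u hu x hx hx1 => ?_⟩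
  · calc (1 : ℝ) / (4 * N) = 1 / 2 * (1 / 2) / N := by field_simp; norm_num
      _ ≤ _ := by gcongr
  have hs1 : 1 + α < s := by linarith [hα.2]
  have hsσ : s ≤ σ := (hσ₀.1.trans hσ.1).le
  have hnear := linOp_ball_sub_le hK hlam.le hLam0.le (by linarith [hα.1]) hσ.2 hC hφ.continuous
    (x := x) (δ := δ) (ε := ε) (k := k) B
    (fun z hz => hT x (ball_subset_ball hδ1 hx) z (ball_subset_ball hδ1 hz))
    (fun z hz hz0 => by
      rw [mem_ball_zero_iff] at hz
      exact (hk z hz0 (by linarith)).trans (hω2 z (by linarith)))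
  have hfar := linOp_compl_ball_le hK hlam.le hLam0.le hα.1.le hs1 hsσ hσ.2 hC.le hM.le hu hx1 hδ
  rw [← laplacian_eq_sum, ← hLdef] at hnear
  have hfar2 : C * F ≤ 1 / 2 * (C * J) / N * (lam * |L| / 4) :=
    calc C * F ≤ lam * |L| / (16 * N * (F + 1)) * F := by gcongr
      _ ≤ lam * |L| / (16 * N) := by
          rw [div_mul_eq_mul_div, div_le_div_iff₀ (by positivity) (by positivity)]
          have : 0 ≤ lam * |L| * (16 * N) := by positivity
          nlinarith
      _ = 1 / 2 * (1 / 2) / N * (lam * |L| / 4) := by field_simp; norm_num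
      _ ≤ _ := by gcongr
  have hnear2 : 1 / 2 * (C * J) * (ε * (Lam + ‖B‖)) = 1 / 2 * (C * J) / N * (lam * |L| / 4) := by
    rw [hε]; field_simp
  have hsplit : linOp K (ball 0 δ) φ x + linOp K (ball 0 δ)ᶜ u x -
      1 / 2 * (C * J) / N * (k * L) =
      (linOp K (ball 0 δ) φ x - 1 / 2 * (C * J) * (k * (L / N))) +
        linOp K (ball 0 δ)ᶜ u x := by ring
  rw [hsplit]
  refine (abs_add_le _ _).trans ?_
  linarith

/-- In `ℝ` the infimum or supremum of an unbounded family is `0`, so a one-sided bound on the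
entries is not enough; `b` only ensures boundedness. -/
lemma iInf_iSup_le {ι κ : Type*} [Nonempty ι] [Nonempty κ] {v : ι → κ → ℝ} {b t : ℝ}
    (hb : ∀ i j, b ≤ v i j) (ht : ∀ i j, v i j ≤ t) : ⨅ i, ⨆ j, v i j ≤ t := by
  have hbdd : ∀ i, BddAbove (Set.range (v i)) := fun i => ⟨t, by rintro _ ⟨j, rfl⟩; exact ht i j⟩
  refine (ciInf_le ⟨b, ?_⟩ (Classical.arbitrary ι)).trans (ciSup_le fun j => ht _ j)
  rintro _ ⟨i, rfl⟩
  exact (hb i (Classical.arbitrary κ)).trans (le_ciSup (hbdd i) _)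

lemma le_iInf_iSup {ι κ : Type*} [Nonempty ι] [Nonempty κ] {v : ι → κ → ℝ} {b t : ℝ}
    (hb : ∀ i j, v i j ≤ b) (ht : ∀ i j, t ≤ v i j) : t ≤ ⨅ i, ⨆ j, v i j :=
  le_ciInf fun i => (ht i (Classical.arbitrary κ)).trans
    (le_ciSup (f := v i) ⟨b, by rintro _ ⟨j, rfl⟩; exact hb i j⟩ _)

/-- The operators have the sign of `Δφ(x₀)`, quantitatively. -/
lemma exists_isaacsEval_estimate {N : ℕ} [NeZero N] {lam Lam M α : ℝ} {ω : ℝ≥0 → ℝ≥0}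
    (hlam : 0 < lam) (hLam : lam ≤ Lam) (hM : 0 < M) (hα : α ∈ Set.Ioo (0 : ℝ) 1)
    (hω : Tendsto ω (𝓝 0) (𝓝 0)) {φ : E N → ℝ} (hφ : ContDiff ℝ 2 φ) {x₀ : E N}
    (hL : Laplacian.laplacian φ x₀ ≠ 0) {r : ℝ} (hr : 0 < r) :
    ∃ m > 0, ∃ δ ∈ Set.Ioo 0 r, ∃ σ₀ ∈ Set.Ioo (1 + α) 2, ∀ σ ∈ Set.Ioo σ₀ 2,
      ∀ (ι : Type*) (κ : Type*) [Nonempty ι] [Nonempty κ] (γ η : ℝ) (K : ι → κ → E N → ℝ)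
        (k : ι → κ → ℝ) (p : E N) (u : E N → ℝ),
        IsAlmostSolution γ lam Lam M α ω η σ K k p u →
      ∀ x ∈ ball x₀ δ, ‖x‖ ≤ 1 →
        (Laplacian.laplacian φ x₀ < 0 → isaacsEval K δ u φ x ≤ -m) ∧
        (0 < Laplacian.laplacian φ x₀ → m ≤ isaacsEval K δ u φ x) := by
  obtain ⟨δ, hδ, σ₀, hσ₀, h⟩ := exists_linOp_estimate hlam hLam hM hα hω hφ hL hr
  set L := Laplacian.laplacian φ x₀
  have hN : 0 < (N : ℝ) := by exact_mod_cast NeZero.pos N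
  have hLp : 0 < |L| := abs_pos.mpr hL
  refine ⟨1 / (4 * N) * (lam * |L| / 2), by positivity, δ, hδ, σ₀, hσ₀,
    fun σ hσ ι κ _ _ γ η K k p u hu x hx hx1 => ?_⟩
  obtain ⟨a, ha, h⟩ := h σ hσ
  have ha0 : 0 < a := lt_of_lt_of_le (by positivity) ha
  have hest := fun i j => abs_le.mp
    (h (K i j) (k i j) (hu.elliptic i j) (hu.close i j) u hu.growth x hx hx1)
  have hm : 1 / (4 * N) * (lam * |L| / 2) ≤ a * (lam * |L| / 2) := by gcongr
  have e : a * (lam * |L| / 2) = a * (lam * |L|) / 2 := by ring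
  constructor
  · intro hneg
    have habs : |L| = -L := abs_of_neg hneg
    refine iInf_iSup_le (b := a * (Lam * L) - a * (lam * |L| / 2)) (fun i j => ?_) fun i j => ?_
    · have : a * (Lam * L) ≤ a * (k i j * L) :=
        mul_le_mul_of_nonneg_left (mul_le_mul_of_nonpos_right (hu.mem_Icc i j).2 hneg.le) ha0.le
      linarith [(hest i j).1]
    · have : a * (k i j * L) ≤ a * (lam * L) :=
        mul_le_mul_of_nonneg_left (mul_le_mul_of_nonpos_right (hu.mem_Icc i j).1 hneg.le) ha0.le
      have e2 : a * (lam * |L|) = -(a * (lam * L)) := by rw [habs]; ring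
      linarith [(hest i j).2]
  · intro hpos
    have habs : |L| = L := abs_of_pos hpos
    refine le_iInf_iSup (b := a * (Lam * L) + a * (lam * |L| / 2)) (fun i j => ?_) fun i j => ?_
    · have : a * (k i j * L) ≤ a * (Lam * L) :=
        mul_le_mul_of_nonneg_left (mul_le_mul_of_nonneg_right (hu.mem_Icc i j).2 hpos.le) ha0.le
      linarith [(hest i j).2]
    · have : a * (lam * L) ≤ a * (k i j * L) :=
        mul_le_mul_of_nonneg_left (mul_le_mul_of_nonneg_right (hu.mem_Icc i j).1 hpos.le) ha0.le
      have e2 : a * (lam * |L|) = a * (lam * L) := by rw [habs]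
      linarith [(hest i j).1]

/-- At a contact point with a test function of the wrong convexity the gradient is nearly `-p`. -/
lemma exists_contact_gradient_lt {N : ℕ} [NeZero N] {lam Lam M α γ : ℝ} {ω : ℝ≥0 → ℝ≥0}
    (hγ : 0 < γ)
    (hlam : 0 < lam) (hLam : lam ≤ Lam) (hM : 0 < M) (hα : α ∈ Set.Ioo (0 : ℝ) 1)
    (hω : Tendsto ω (𝓝 0) (𝓝 0)) {φ : E N → ℝ} (hφ : ContDiff ℝ 2 φ) {x₀ : E N}
    (hL : Laplacian.laplacian φ x₀ ≠ 0) {r c : ℝ} (hr : 0 < r) (hc : 0 < c) :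
    ∃ δ ∈ Set.Ioo 0 r, ∃ σ₀ ∈ Set.Ioo (1 + α) 2, ∃ η₀ > 0, ∀ σ ∈ Set.Ioo σ₀ 2, ∀ η < η₀,
      ∀ (ι : Type*) (κ : Type*) [Nonempty ι] [Nonempty κ] (K : ι → κ → E N → ℝ)
        (k : ι → κ → ℝ) (p : E N) (u : E N → ℝ),
        IsAlmostSolution γ lam Lam M α ω η σ K k p u →
      ∀ x ∈ ball x₀ δ, x ∈ ball (0 : E N) 1 →
        (Laplacian.laplacian φ x₀ < 0 → (∀ y ∈ ball x δ, u y - φ y ≤ u x - φ x) →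
          ‖gradient φ x + p‖ < c) ∧
        (0 < Laplacian.laplacian φ x₀ → (∀ y ∈ ball x δ, u x - φ x ≤ u y - φ y) →
          ‖gradient φ x + p‖ < c) := by
  obtain ⟨m, hm, δ, hδ, σ₀, hσ₀, h⟩ := exists_isaacsEval_estimate hlam hLam hM hα hω hφ hL hr
  -- A gradient at distance at least `c` from `-p` is admissible in the equation and would force `c
  -- ^ γ * m ≤ η`.
  refine ⟨δ, hδ, σ₀, hσ₀, c ^ γ * m, by positivity,
    fun σ hσ η hη ι κ _ _ K k p u hu x hx hx1 => ?_⟩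
  have hx1' : ‖x‖ ≤ 1 := (mem_ball_zero_iff.mp hx1).le
  obtain ⟨hsub, hsup⟩ := h σ hσ ι κ γ η K k p u hu x hx hx1'
  have hne : c ≤ ‖gradient φ x + p‖ → gradient φ x ≠ -p := by
    intro hcon heq
    rw [heq] at hcon
    simp at hcon
    linarith
  have hpow : c ≤ ‖gradient φ x + p‖ → c ^ γ * m ≤ ‖gradient φ x + p‖ ^ γ * m := fun hcon => by
    gcongr
  constructor
  · intro hneg hmax
    by_contra! hcon
    have h1 := hu.sub.test x hx1 φ hφ δ hδ.1 hmax (hne hcon)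
    have h2 := mul_le_mul_of_nonneg_left (hsub hneg)
      (by positivity : 0 ≤ ‖gradient φ x + p‖ ^ γ)
    linarith [hpow hcon]
  · intro hpos hmin
    by_contra! hcon
    have h1 := hu.super.test x hx1 φ hφ δ hδ.1 hmin (hne hcon)
    have h2 := mul_le_mul_of_nonneg_left (hsup hpos)
      (by positivity : 0 ≤ ‖gradient φ x + p‖ ^ γ)
    linarith [hpow hcon]

/-! ### Translating, negating and perturbing test functions. -/

lemma gradient_comp_sub {N : ℕ} (φ : E N → ℝ) (v x : E N) :
    gradient (fun y => φ (y - v)) x = gradient φ (x - v) := by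
  simp only [gradient, fderiv_comp_sub]

lemma laplacian_comp_sub {N : ℕ} (φ : E N → ℝ) (v x : E N) :
    Laplacian.laplacian (fun y => φ (y - v)) x = Laplacian.laplacian φ (x - v) := by
  have h : fderiv ℝ (fun y => φ (y - v)) = fun y => fderiv ℝ φ (y - v) := by
    ext1 y
    rw [fderiv_comp_sub]
  simp only [laplacian_eq_sum, h, fderiv_comp_sub]

lemma gradient_neg_fun {N : ℕ} (φ : E N → ℝ) (x : E N) :
    gradient (fun y => -φ y) x = -gradient φ x := by
  simp only [gradient, fderiv_fun_neg, map_neg]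

lemma laplacian_neg_fun {N : ℕ} (φ : E N → ℝ) (x : E N) :
    Laplacian.laplacian (fun y => -φ y) x = -Laplacian.laplacian φ x := by
  have h : fderiv ℝ (fun y => -φ y) = fun y => -fderiv ℝ φ y := by
    ext1 y
    rw [fderiv_fun_neg]
  simp [laplacian_eq_sum, h, fderiv_fun_neg]

lemma continuous_laplacian {N : ℕ} {φ : E N → ℝ} (hφ : ContDiff ℝ 2 φ) :
    Continuous (Laplacian.laplacian φ : E N → ℝ) := by
  have h : Continuous (fderiv ℝ (fderiv ℝ φ)) :=
    (hφ.fderiv_right (m := 1) (by norm_num)).continuous_fderiv (by norm_num)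
  have : (Laplacian.laplacian φ : E N → ℝ) = fun x => ∑ i, fderiv ℝ (fderiv ℝ φ) x
      (EuclideanSpace.single i 1) (EuclideanSpace.single i 1) := funext (laplacian_eq_sum φ)
  rw [this]
  fun_prop

lemma continuous_gradient {N : ℕ} {φ : E N → ℝ} (hφ : ContDiff ℝ 2 φ) :
    Continuous (gradient φ) :=
  (InnerProductSpace.toDual ℝ (E N)).symm.continuous.comp (hφ.continuous_fderiv (by norm_num))

/-- A test function with `Δφ(x₀) < 0` can be made to touch strictly. -/
lemma exists_strict_perturbation {N : ℕ} [NeZero N] {φ : E N → ℝ} (hφ : ContDiff ℝ 2 φ)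
    {x₀ : E N} (hL : Laplacian.laplacian φ x₀ < 0) :
    ∃ t > 0, ContDiff ℝ 2 (fun y => φ y + t * ‖y - x₀‖ ^ 2) ∧
      Laplacian.laplacian (fun y => φ y + t * ‖y - x₀‖ ^ 2) x₀ < 0 ∧
      gradient (fun y => φ y + t * ‖y - x₀‖ ^ 2) x₀ = gradient φ x₀ := by
  have hN : 0 < (N : ℝ) := by exact_mod_cast NeZero.pos N
  -- The added paraboloid has Laplacian `2 * N * t`, so half of the negative Laplacian survives.
  set t : ℝ := -Laplacian.laplacian φ x₀ / (4 * N) with ht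
  have ht0 : 0 < t := div_pos (by linarith) (by positivity)
  have hsq : ContDiff ℝ 2 fun y : E N => t * ‖y - x₀‖ ^ 2 := by
    have := (contDiff_id.sub contDiff_const : ContDiff ℝ 2 fun y : E N => y - x₀).norm_sq ℝ
    exact contDiff_const.mul this
  set T : E N →L[ℝ] E N →L[ℝ] ℝ :=
    (isBoundedBilinearMap_inner (𝕜 := ℝ) (E := E N)).toContinuousLinearMap
  have hT : ∀ v y : E N, T v y = inner ℝ v y := fun _ _ => rfl
  have hf : ∀ y, HasFDerivAt (fun y : E N => φ y + t * ‖y - x₀‖ ^ 2)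
      (fderiv ℝ φ y + (2 * t) • T (y - x₀)) y := by
    intro y
    have h1 := (hφ.differentiable (by norm_num) y).hasFDerivAt
    have h2 := (((hasFDerivAt_id y).sub_const x₀).norm_sq).const_mul t
    convert! h1.add h2 using 1
    ext v
    simp [hT]
    ring
  have hf' : fderiv ℝ (fun y : E N => φ y + t * ‖y - x₀‖ ^ 2) =
      fun y => fderiv ℝ φ y + (2 * t) • T (y - x₀) := funext fun y => (hf y).fderiv
  have hff : HasFDerivAt (fun y => fderiv ℝ φ y + (2 * t) • T (y - x₀))
      (fderiv ℝ (fderiv ℝ φ) x₀ + (2 * t) • T) x₀ := by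
    have h1 := ((hφ.fderiv_right (m := 1) (by norm_num)).differentiable (by norm_num)
      x₀).hasFDerivAt
    have h2 : HasFDerivAt (fun y : E N => T (y - x₀)) T x₀ := by
      have h3 : HasFDerivAt (fun y : E N => y - x₀) (ContinuousLinearMap.id ℝ (E N)) x₀ :=
        (hasFDerivAt_id x₀).sub_const x₀
      exact (T.hasFDerivAt (x := x₀ - x₀)).comp (f := fun y => y - x₀) x₀ h3
    exact h1.add (h2.fun_const_smul (2 * t))
  refine ⟨t, ht0, hφ.add hsq, ?_, ?_⟩
  · rw [laplacian_eq_sum, hf', hff.fderiv]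
    simp only [FunLike.coe_add, Pi.add_apply, Finset.sum_add_distrib]
    rw [← laplacian_eq_sum]
    simp [hT]
    rw [ht]
    field_simp
    linarith
  · simp [gradient, hf']

/-- If `Δφ(x₀) < 0`, then `φ` minus any linear function has no local minimum at `x₀`. -/
lemma exists_lt_of_laplacian_neg {N : ℕ} [NeZero N] {φ : E N → ℝ} (hφ : ContDiff ℝ 2 φ)
    {x₀ : E N} (hL : Laplacian.laplacian φ x₀ < 0) (q : E N) {ρ : ℝ} (hρ : 0 < ρ) :
    ∃ a : E N, ‖a‖ < ρ ∧ φ (x₀ - a) + inner ℝ q a < φ x₀ := by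
  by_contra! hcon
  have hN : 0 < (N : ℝ) := by exact_mod_cast NeZero.pos N
  set ε : ℝ := -Laplacian.laplacian φ x₀ / (2 * N) with hε
  have hε0 : 0 < ε := div_pos (by linarith) (by positivity)
  obtain ⟨δ, hδ, hT⟩ := exists_second_difference_bound hφ x₀ hε0
  set τ : ℝ := min δ ρ / 2 with hτ
  have hτ0 : 0 < τ := by positivity
  have hτδ : τ < δ := by linarith [min_le_left δ ρ, hτ]
  have hτρ : τ < ρ := by linarith [min_le_right δ ρ, hτ]
  have hi : ∀ i, -ε ≤ fderiv ℝ (fderiv ℝ φ) x₀ (EuclideanSpace.single i 1)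
      (EuclideanSpace.single i 1) := by
    -- Adding the inequalities for `τ • e` and `-(τ • e)` cancels `q` and leaves a nonnegative
    -- second difference. Summing over `i` bounds the Laplacian below by half its negative value.
    intro i
    set e : E N := EuclideanSpace.single i 1 with he
    have hnorm : ‖τ • e‖ = τ := by simp [he, norm_smul, abs_of_pos hτ0]
    have h1 := abs_le.mp (hT x₀ (mem_ball_self hδ) (τ • e) (by simpa [hnorm] using hτδ))
    have h2 := hcon (τ • e) (by rw [hnorm]; exact hτρ)
    have h3 := hcon (-(τ • e)) (by rw [norm_neg, hnorm]; exact hτρ)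
    rw [sub_neg_eq_add, inner_neg_right] at h3
    rw [hnorm] at h1
    simp only [map_smul, FunLike.coe_smul, Pi.smul_apply, smul_eq_mul] at h1
    have h4 : 0 ≤ τ ^ 2 * (fderiv ℝ (fderiv ℝ φ) x₀ e e + ε) := by linarith [h1.1, h1.2]
    have := nonneg_of_mul_nonneg_right h4 (by positivity)
    linarith
  have hsum := Finset.sum_le_sum fun i (_ : i ∈ Finset.univ) => hi i
  rw [← laplacian_eq_sum] at hsum
  simp at hsum
  have : N * ε = -Laplacian.laplacian φ x₀ / 2 := by rw [hε]; field_simp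
  linarith

/-! ### Contact gradients and the limit function. -/

/-- Wherever a test function with `Δφ < 0` touches `w n` from above, its gradient is
asymptotically `-p n`. -/
def HasContactGradients {N : ℕ} (w : ℕ → E N → ℝ) (p : ℕ → E N) : Prop :=
  ∀ φ : E N → ℝ, ContDiff ℝ 2 φ → ∀ x₀ ∈ ball (0 : E N) 1, Laplacian.laplacian φ x₀ < 0 →
    ∀ r > 0, ∀ c > 0, ∃ δ ∈ Set.Ioo 0 r, ∀ᶠ n in atTop, ∀ x ∈ ball x₀ δ, x ∈ ball (0 : E N) 1 →
      (∀ y ∈ ball x δ, w n y - φ y ≤ w n x - φ x) → ‖gradient φ x + p n‖ < c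

lemma exists_closedBall_of_isLocalMax {N : ℕ} {w φ : E N → ℝ} {x₀ : E N}
    (hx₀ : x₀ ∈ ball (0 : E N) 1) (hmax : IsLocalMax (fun y => w y - φ y) x₀) :
    ∃ R > 0, closedBall x₀ R ⊆ ball 0 1 ∧
      ∀ y ∈ closedBall x₀ R, w y - φ y ≤ w x₀ - φ x₀ := by
  have h := hmax.and (isOpen_ball.mem_nhds hx₀)
  obtain ⟨R, hR, h⟩ := Metric.nhds_basis_closedBall.eventually_iff.mp h
  exact ⟨R, hR, fun y hy => (h hy).2, fun y hy => (h hy).1⟩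

/-- A strict contact of the limit persists: `w n - ψ` has a maximum point near `x₀`, where the
gradient of `ψ` is close both to `Dφ(x₀)` and to `-p n`. No bound on `p` is assumed. -/
lemma tendsto_of_contact {N : ℕ} [NeZero N] {w : ℕ → E N → ℝ} {p : ℕ → E N} {w₀ : E N → ℝ}
    (hw : ∀ n, Continuous (w n))
    (hlim : TendstoUniformlyOn w w₀ atTop (closedBall 0 1)) (hp : HasContactGradients w p)
    {φ : E N → ℝ} (hφ : ContDiff ℝ 2 φ) {x₀ : E N} (hx₀ : x₀ ∈ ball (0 : E N) 1)
    (hmax : IsLocalMax (fun y => w₀ y - φ y) x₀) (hL : Laplacian.laplacian φ x₀ < 0) :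
    Tendsto p atTop (𝓝 (-gradient φ x₀)) := by
  obtain ⟨R, hR, hRball, hRmax⟩ := exists_closedBall_of_isLocalMax hx₀ hmax
  obtain ⟨t, ht, hψ, hψL, hψg⟩ := exists_strict_perturbation hφ hL
  set ψ : E N → ℝ := fun y => φ y + t * ‖y - x₀‖ ^ 2 with hψdef
  rw [Metric.tendsto_atTop']
  intro c hc
  obtain ⟨r₁, hr₁, hgrad⟩ := Metric.continuous_iff.mp (continuous_gradient hψ) x₀ (c / 2)
    (by positivity)
  obtain ⟨δ, hδ, hev⟩ := hp ψ hψ x₀ hx₀ hψL (min (R / 2) r₁) (by positivity) (c / 2)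
    (by positivity)
  have hδR : δ < R / 2 := hδ.2.trans_le (min_le_left _ _)
  have hδr : δ < r₁ := hδ.2.trans_le (min_le_right _ _)
  have hδ0 := hδ.1
  -- Twice this error is the gap `t * δ ^ 2` of the strict contact at distance `δ`, so maximum
  -- points of `w n - ψ` lie in `ball x₀ δ`.
  have hunif := Metric.tendstoUniformlyOn_iff.mp hlim (t * δ ^ 2 / 2) (by positivity)
  have hall : ∀ᶠ n in atTop, dist (p n) (-gradient φ x₀) < c := by
    filter_upwards [hev, hunif] with n hn hun
    obtain ⟨x, hxR, hxmax⟩ := (isCompact_closedBall x₀ R).exists_isMaxOn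
      ⟨x₀, mem_closedBall_self hR.le⟩
      (((hw n).sub hψ.continuous).continuousOn (s := closedBall x₀ R))
    have hxmax' : ∀ y ∈ closedBall x₀ R, w n y - ψ y ≤ w n x - ψ x := fun y hy => hxmax hy
    have hx1 := hun x (ball_subset_closedBall (hRball hxR))
    have hx2 := hun x₀ (ball_subset_closedBall hx₀)
    rw [Real.dist_eq, abs_lt] at hx1 hx2
    have h1 := hxmax' x₀ (mem_closedBall_self hR.le)
    have h2 := hRmax x hxR
    simp only [hψdef, sub_self, norm_zero] at h1
    have h3 : t * ‖x - x₀‖ ^ 2 < t * δ ^ 2 := by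
      nlinarith [hx1.1, hx1.2, hx2.1, hx2.2]
    have h4 : ‖x - x₀‖ < δ :=
      lt_of_pow_lt_pow_left₀ 2 hδ0.le (lt_of_mul_lt_mul_left h3 ht.le)
    have hxδ : x ∈ ball x₀ δ := by rwa [mem_ball, dist_eq_norm]
    have h5 := hn x hxδ (hRball hxR) fun y hy => hxmax' y <| by
      rw [mem_ball] at hy hxδ
      rw [mem_closedBall]
      linarith [dist_triangle y x x₀]
    have h6 := hgrad x (by rw [mem_ball] at hxδ; linarith)
    rw [hψg, dist_eq_norm] at h6
    rw [dist_eq_norm]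
    calc ‖p n - -gradient φ x₀‖
        = ‖(gradient ψ x + p n) - (gradient ψ x - gradient φ x₀)‖ := by congr 1; abel
      _ ≤ _ := norm_sub_le _ _
      _ < c := by linarith
  obtain ⟨n, hn⟩ := eventually_atTop.mp hall
  exact ⟨n, fun m hm => hn m hm.le⟩

/-- If all functions with negative Laplacian touching `w` from above have the same gradient at
the contact point, then there are none. -/
lemma laplacian_nonneg_of_gradient_eq {N : ℕ} [NeZero N] {w : E N → ℝ}
    (hw : ContinuousOn w (closedBall 0 1)) (q : E N)
    (hq : ∀ φ : E N → ℝ, ContDiff ℝ 2 φ → ∀ x₀ ∈ ball (0 : E N) 1,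
      IsLocalMax (fun y => w y - φ y) x₀ → Laplacian.laplacian φ x₀ < 0 → gradient φ x₀ = q)
    {φ : E N → ℝ} (hφ : ContDiff ℝ 2 φ) {x₀ : E N} (hx₀ : x₀ ∈ ball (0 : E N) 1)
    (hmax : IsLocalMax (fun y => w y - φ y) x₀) : 0 ≤ Laplacian.laplacian φ x₀ := by
  by_contra! hL
  obtain ⟨R₁, hR₁, hRball, hRmax⟩ := exists_closedBall_of_isLocalMax hx₀ hmax
  obtain ⟨t, ht, hψ, hψL, -⟩ := exists_strict_perturbation hφ hL
  set ψ : E N → ℝ := fun y => φ y + t * ‖y - x₀‖ ^ 2 with hψdef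
  have hstrict : ∀ y ∈ closedBall x₀ R₁, w y - ψ y ≤ w x₀ - ψ x₀ - t * ‖y - x₀‖ ^ 2 := by
    intro y hy
    have := hRmax y hy
    simp only [hψdef, sub_self, norm_zero]
    linarith
  obtain ⟨r₂, hr₂, hneg⟩ := Metric.eventually_nhds_iff.mp
    ((continuous_laplacian hψ).continuousAt.eventually (Iio_mem_nhds hψL))
  -- Contact points shifted by at most `R` stay within `2 * R < r₂` of `x₀`, where `Δψ < 0`.
  set R : ℝ := min R₁ (r₂ / 3) with hRdef
  have hR : 0 < R := by positivity
  have hRR : R ≤ R₁ := min_le_left _ _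
  have hRr : R ≤ r₂ / 3 := min_le_right _ _
  have huc := (isCompact_closedBall x₀ (2 * R)).uniformContinuousOn_of_continuous
    hψ.continuous.continuousOn
  obtain ⟨ρ, hρ, hψρ⟩ := Metric.uniformContinuousOn_iff.mp huc (t * R ^ 2 / 2) (by positivity)
  obtain ⟨a, ha, hlt⟩ := exists_lt_of_laplacian_neg hψ hψL q (lt_min hρ hR)
  set μ : ℝ := (ψ x₀ - (ψ (x₀ - a) + inner ℝ q a)) / 2 with hμ
  have hμ0 : 0 < μ := by linarith
  -- Maximizing jointly in the shift `b` and the point gives a contact and differentiates the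
  -- contact level at once. The slope `q·a + μ` lies strictly between `q·a` and the gain `ψ x₀ - ψ
  -- (x₀ - a)`.
  set F : ℝ × E N → ℝ := fun b => w b.2 - ψ (b.2 - b.1 • a) - b.1 * (inner ℝ q a + μ) with hF
  have hw' : ContinuousOn w (closedBall x₀ R) :=
    hw.mono ((closedBall_subset_closedBall hRR).trans (hRball.trans ball_subset_closedBall))
  have hFc : ContinuousOn F (Set.Icc 0 1 ×ˢ closedBall x₀ R) := by
    refine ContinuousOn.sub (ContinuousOn.sub (hw'.comp continuousOn_snd fun b hb => hb.2) ?_)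
      (by fun_prop)
    exact (hψ.continuous.comp (by fun_prop)).continuousOn
  obtain ⟨⟨b, x⟩, ⟨hb, hx⟩, hbx⟩ := (isCompact_Icc.prod (isCompact_closedBall x₀ R)).exists_isMaxOn
    (⟨(0, x₀), ⟨by simp, mem_closedBall_self hR.le⟩⟩) hFc
  replace hbx : ∀ b' ∈ Set.Icc (0 : ℝ) 1, ∀ y ∈ closedBall x₀ R, F (b', y) ≤ F (b, x) :=
    fun b' hb' y hy => hbx (Set.mk_mem_prod hb' hy)
  simp only at hb hx
  have hba : ‖b • a‖ < min ρ R := by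
    rw [norm_smul, Real.norm_of_nonneg hb.1]
    exact lt_of_le_of_lt (mul_le_of_le_one_left (norm_nonneg _) hb.2) ha
  have hshift : ∀ y ∈ closedBall x₀ R, |ψ (y - b • a) - ψ y| < t * R ^ 2 / 2 := by
    intro y hy
    rw [mem_closedBall] at hy
    refine hψρ _ ?_ _ ?_ ?_
    · rw [mem_closedBall]
      have : dist (y - b • a) y = ‖b • a‖ := by rw [dist_self_sub_left]
      linarith [dist_triangle (y - b • a) y x₀, min_le_right ρ R]
    · rw [mem_closedBall]; linarith
    · rw [dist_self_sub_left]
      exact hba.trans_le (min_le_left _ _)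
  have hxint : x ∈ ball x₀ R := by
    have h1 := hbx b hb x₀ (mem_closedBall_self hR.le)
    have h2 := abs_lt.mp (hshift x hx)
    have h3 := abs_lt.mp (hshift x₀ (mem_closedBall_self hR.le))
    have h4 := hstrict x (closedBall_subset_closedBall hRR hx)
    simp only [hF] at h1
    have h5 : t * ‖x - x₀‖ ^ 2 < t * R ^ 2 := by linarith [h2.1, h2.2, h3.1, h3.2]
    rw [mem_ball, dist_eq_norm]
    exact lt_of_pow_lt_pow_left₀ 2 hR.le (lt_of_mul_lt_mul_left h5 ht.le)
  -- At `b = 0` the value is at most `w x₀ - ψ x₀`, while `F (1, x₀)` exceeds it by `μ`.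
  have hb0 : 0 < b := by
    rcases hb.1.eq_or_lt with h | h
    · exfalso
      subst h
      have h1 := hbx 1 (by simp) x₀ (mem_closedBall_self hR.le)
      have h4 := hstrict x (closedBall_subset_closedBall hRR hx)
      have : 0 ≤ t * ‖x - x₀‖ ^ 2 := by positivity
      simp only [hF, one_smul, zero_smul, sub_zero, one_mul, zero_mul] at h1
      linarith
    · exact h
  have hgrad : gradient ψ (x - b • a) = q := by
    rw [← gradient_comp_sub ψ (b • a)]
    refine hq (fun y => ψ (y - b • a)) (hψ.comp (contDiff_id.sub contDiff_const)) x
      (hRball (closedBall_subset_closedBall hRR hx)) ?_ ?_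
    · filter_upwards [isOpen_ball.mem_nhds hxint] with y hy
      have := hbx b hb y (ball_subset_closedBall hy)
      simp only [hF] at this
      linarith
    · rw [laplacian_comp_sub]
      refine hneg ?_
      rw [mem_ball] at hxint
      have : dist (x - b • a) x = ‖b • a‖ := by rw [dist_self_sub_left]
      linarith [dist_triangle (x - b • a) x x₀, min_le_right ρ R]
  have hder : HasDerivAt (fun s : ℝ => F (s, x)) (-μ) b := by
    have h1 : HasDerivAt (fun s : ℝ => x - s • a) (-a) b := by
      simpa using ((hasDerivAt_id b).smul_const a).const_sub x
    have h2 := (hψ.differentiable (by norm_num) (x - b • a)).hasFDerivAt.comp_hasDerivAt b h1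
    have h3 : fderiv ℝ ψ (x - b • a) a = inner ℝ q a := by
      rw [← hgrad, gradient, InnerProductSpace.toDual_symm_apply]
    have h4 := (h2.const_sub (w x)).sub ((hasDerivAt_id b).mul_const (inner ℝ q a + μ))
    convert! h4 using 1
    rw [map_neg, h3]
    ring
  -- The maximum may sit at `b = 1`, so only left slopes are used; they are nonnegative, against the
  -- derivative `-μ`.
  have hslope := (hasDerivWithinAt_iff_tendsto_slope' (s := Set.Iio b) (by simp)).mp
    hder.hasDerivWithinAt
  have hle : ∀ᶠ s in 𝓝[<] b, 0 ≤ slope (fun s : ℝ => F (s, x)) b s := by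
    filter_upwards [Ioo_mem_nhdsLT hb0] with s hs
    rw [slope_def_field]
    exact div_nonneg_of_nonpos
      (by linarith [hbx s ⟨hs.1.le, hs.2.le.trans hb.2⟩ x hx]) (by linarith [hs.2])
  have := ge_of_tendsto hslope hle
  linarith

lemma laplacian_nonneg_of_contact {N : ℕ} [NeZero N] {w : ℕ → E N → ℝ} {p : ℕ → E N}
    {w₀ : E N → ℝ} (hw : ∀ n, Continuous (w n))
    (hlim : TendstoUniformlyOn w w₀ atTop (closedBall 0 1)) (hp : HasContactGradients w p)
    {φ : E N → ℝ} (hφ : ContDiff ℝ 2 φ) {x₀ : E N} (hx₀ : x₀ ∈ ball (0 : E N) 1)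
    (hmax : IsLocalMax (fun y => w₀ y - φ y) x₀) : 0 ≤ Laplacian.laplacian φ x₀ := by
  by_contra! hL
  have hpφ := tendsto_of_contact hw hlim hp hφ hx₀ hmax hL
  have hw₀ : ContinuousOn w₀ (closedBall 0 1) :=
    hlim.continuousOn (Frequently.of_forall fun n => (hw n).continuousOn)
  refine hL.not_ge (laplacian_nonneg_of_gradient_eq hw₀ (gradient φ x₀) ?_ hφ hx₀ hmax)
  intro φ' hφ' x₁ hx₁ hmax' hL'
  exact neg_injective
    (tendsto_nhds_unique (tendsto_of_contact hw hlim hp hφ' hx₁ hmax' hL') hpφ)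

/-! ### Compactness, harmonic limits and the conclusion. -/

/-- Bounded functions with a common modulus of continuity on the closed unit ball have a
uniformly convergent subsequence there. -/
lemma exists_uniform_limit {N : ℕ} {ω : ℝ≥0 → ℝ≥0} (hω : Tendsto ω (𝓝 0) (𝓝 0)) {M : ℝ}
    {u : ℕ → E N → ℝ} (hu : ∀ n, Continuous (u n))
    (hmod : ∀ n, ∀ x ∈ closedBall (0 : E N) 1, ∀ y ∈ closedBall (0 : E N) 1,
      |u n x - u n y| ≤ ω ‖x - y‖₊)
    (hbd : ∀ n, ∀ x ∈ closedBall (0 : E N) 1, |u n x| ≤ M) :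
    ∃ (u₀ : E N → ℝ) (θ : ℕ → ℕ), StrictMono θ ∧
      TendstoUniformlyOn (fun n => u (θ n)) u₀ atTop (closedBall 0 1) := by
  have : CompactSpace (closedBall (0 : E N) 1) :=
    isCompact_iff_compactSpace.mp (isCompact_closedBall 0 1)
  let F : ℕ → BoundedContinuousFunction (closedBall (0 : E N) 1) ℝ := fun n =>
    BoundedContinuousFunction.mkOfCompact ⟨fun x => u n x, (hu n).comp continuous_subtype_val⟩
  have hF : ∀ n x, F n x = u n x := fun _ _ => rfl
  have hcpt : IsCompact (closure (Set.range F)) := by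
    refine BoundedContinuousFunction.arzela_ascoli (Set.Icc (-M) M) isCompact_Icc _ ?_ ?_
    · rintro f x ⟨n, rfl⟩
      exact abs_le.mp (hbd n x x.2)
    · intro x
      rw [Metric.equicontinuousAt_iff]
      intro e he
      have h := hω.eventually (gt_mem_nhds (show (0 : ℝ≥0) < ⟨e, he.le⟩ from he))
      obtain ⟨δ, hδ, h⟩ := Metric.eventually_nhds_iff.mp h
      refine ⟨δ, hδ, ?_⟩
      rintro y hy ⟨_, n, rfl⟩
      change dist (u n x) (u n y) < e
      rw [Real.dist_eq]
      have h1 : dist ‖(x : E N) - y‖₊ 0 < δ := by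
        rw [Subtype.dist_eq, dist_comm, dist_eq_norm] at hy
        simpa [NNReal.dist_eq] using hy
      exact (hmod n x x.2 y y.2).trans_lt (h h1)
  obtain ⟨f, -, θ, hθ, hlim⟩ := hcpt.tendsto_subseq fun n => subset_closure ⟨n, rfl⟩
  classical
  refine ⟨fun x => if hx : x ∈ closedBall (0 : E N) 1 then f ⟨x, hx⟩ else 0, θ, hθ, ?_⟩
  rw [BoundedContinuousFunction.tendsto_iff_tendstoUniformly] at hlim
  rw [tendstoUniformlyOn_iff_tendstoUniformly_comp_coe]
  convert! hlim using 1
  ext x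
  have hx := x.2
  simp only [Function.comp_apply, dif_pos hx]

/-- Continuous functions that are harmonic in `B_1` in the viscosity sense. -/
structure IsViscosityHarmonic {N : ℕ} (h : E N → ℝ) : Prop where
  cont : ContinuousOn h (ball 0 1)
  sub : ∀ x ∈ ball (0 : E N) 1, ∀ φ : E N → ℝ, ContDiff ℝ 2 φ →
    IsLocalMax (fun y => h y - φ y) x → 0 ≤ Laplacian.laplacian φ x
  super : ∀ x ∈ ball (0 : E N) 1, ∀ φ : E N → ℝ, ContDiff ℝ 2 φ →
    IsLocalMin (fun y => h y - φ y) x → Laplacian.laplacian φ x ≤ 0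

/-- Multiplying by the nonnegative `k i j` and by the gradient power preserves the weak sign of the
Laplacian, at vanishing gradients too. No boundedness is needed, since the default value `0` has
either sign. -/
lemma IsViscosityHarmonic.isLimitSolution {N : ℕ} {ι κ : Type*} {h : E N → ℝ}
    (hh : IsViscosityHarmonic h) (γ : ℝ) {k : ι → κ → ℝ} (hk : ∀ i j, 0 ≤ k i j) :
    IsLimitSolution γ k h where
  cont := hh.cont
  sub x hx φ hφ hmax := by
    have hL := hh.sub x hx φ hφ hmax
    have : 0 ≤ ⨅ i, ⨆ j, k i j * Laplacian.laplacian φ x :=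
      Real.iInf_nonneg fun i => Real.iSup_nonneg fun j => mul_nonneg (hk i j) hL
    exact neg_nonpos.mpr (mul_nonneg (by positivity) this)
  super x hx φ hφ hmin := by
    have hL := hh.super x hx φ hφ hmin
    have : ⨅ i, ⨆ j, k i j * Laplacian.laplacian φ x ≤ 0 :=
      Real.iInf_nonpos fun i => Real.iSup_nonpos fun j =>
        mul_nonpos_of_nonneg_of_nonpos (hk i j) hL
    exact neg_nonneg.mpr (mul_nonpos_of_nonneg_of_nonpos (by positivity) this)

/-- A limit of almost solutions, as `η → 0` and `σ → 2`, is harmonic. -/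
lemma isViscosityHarmonic_of_tendsto {N : ℕ} [NeZero N] {lam Lam M α γ : ℝ} {ω : ℝ≥0 → ℝ≥0}
    (hγ : 0 < γ) (hlam : 0 < lam) (hLam : lam ≤ Lam) (hM : 0 < M) (hα : α ∈ Set.Ioo (0 : ℝ) 1)
    (hω : Tendsto ω (𝓝 0) (𝓝 0)) {η σ : ℕ → ℝ} {u : ℕ → E N → ℝ} {p : ℕ → E N}
    {u₀ : E N → ℝ} (hη : Tendsto η atTop (𝓝 0)) (hσ2 : ∀ n, σ n < 2)
    (hσ : Tendsto σ atTop (𝓝 2))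
    (hu : ∀ n, ∃ (ι : Type*) (κ : Type*) (_ : Nonempty ι) (_ : Nonempty κ)
      (K : ι → κ → E N → ℝ) (k : ι → κ → ℝ),
      IsAlmostSolution γ lam Lam M α ω (η n) (σ n) K k (p n) (u n))
    (hlim : TendstoUniformlyOn u u₀ atTop (closedBall 0 1)) : IsViscosityHarmonic u₀ := by
  have hcont : ∀ n, Continuous (u n) := fun n => by
    obtain ⟨ι, κ, _, _, K, k, h⟩ := hu n
    exact continuous_iff_lower_upperSemicontinuous.mpr ⟨h.super.lsc, h.sub.usc⟩
  have hsub : HasContactGradients u p := by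
    intro φ hφ x₀ hx₀ hL r hr c hc
    obtain ⟨δ, hδ, σ₀, hσ₀, η₀, hη₀, h⟩ :=
      exists_contact_gradient_lt hγ hlam hLam hM hα hω hφ hL.ne hr hc
    refine ⟨δ, hδ, ?_⟩
    filter_upwards [hη.eventually (gt_mem_nhds hη₀), hσ.eventually (lt_mem_nhds hσ₀.2)]
      with n hn hn' x hx hx1 hmax
    obtain ⟨ι, κ, _, _, K, k, hK⟩ := hu n
    exact (h (σ n) ⟨hn', hσ2 n⟩ (η n) hn ι κ K k (p n) (u n) hK x hx hx1).1 hL hmax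
  have hsup : HasContactGradients (fun n x => -u n x) (fun n => -p n) := by
    intro φ hφ x₀ hx₀ hL r hr c hc
    have hL' : 0 < Laplacian.laplacian (fun y => -φ y) x₀ := by
      rw [laplacian_neg_fun]; linarith
    obtain ⟨δ, hδ, σ₀, hσ₀, η₀, hη₀, h⟩ :=
      exists_contact_gradient_lt hγ hlam hLam hM hα hω hφ.neg hL'.ne' hr hc
    refine ⟨δ, hδ, ?_⟩
    filter_upwards [hη.eventually (gt_mem_nhds hη₀), hσ.eventually (lt_mem_nhds hσ₀.2)]
      with n hn hn' x hx hx1 hmax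
    obtain ⟨ι, κ, _, _, K, k, hK⟩ := hu n
    have h1 := (h (σ n) ⟨hn', hσ2 n⟩ (η n) hn ι κ K k (p n) (u n) hK x hx hx1).2 hL'
      fun y hy => by linarith [hmax y hy]
    rw [gradient_neg_fun] at h1
    rwa [← norm_neg, neg_add, neg_neg]
  refine ⟨?_, fun x hx φ hφ hmax => laplacian_nonneg_of_contact hcont hlim hsub hφ hx hmax,
    fun x hx φ hφ hmin => ?_⟩
  · exact (hlim.continuousOn (Frequently.of_forall fun n => (hcont n).continuousOn)).mono
      ball_subset_closedBall
  · have hlim' : TendstoUniformlyOn (fun n x => -u n x) (fun x => -u₀ x) atTop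
        (closedBall 0 1) := by
      rw [Metric.tendstoUniformlyOn_iff] at hlim ⊢
      simpa only [dist_neg_neg] using hlim
    have h := laplacian_nonneg_of_contact (fun n => (hcont n).neg) hlim' hsup hφ.neg hx
      (by
        filter_upwards [hmin] with y hy
        linarith)
    rw [laplacian_neg_fun] at h
    linarith

lemma exists_viscosityHarmonic_near {N : ℕ} [NeZero N] {lam Lam M α γ : ℝ} {ω : ℝ≥0 → ℝ≥0}
    (hγ : 0 < γ) (hlam : 0 < lam) (hLam : lam ≤ Lam) (hM : 0 < M) (hα : α ∈ Set.Ioo (0 : ℝ) 1)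
    (hω : Tendsto ω (𝓝 0) (𝓝 0)) {ε : ℝ} (hε : 0 < ε) :
    ∃ η ∈ Set.Ioo (0 : ℝ) 1, ∃ σ₀ ∈ Set.Ioo (1 + α) 2, ∀ σ ∈ Set.Ioo σ₀ 2,
      ∀ (ι : Type*) (κ : Type*) [Nonempty ι] [Nonempty κ] (K : ι → κ → E N → ℝ) (k : ι → κ → ℝ)
        (p : E N) (u : E N → ℝ), IsAlmostSolution γ lam Lam M α ω η σ K k p u →
        ∃ h : E N → ℝ, IsViscosityHarmonic h ∧ ∀ x ∈ ball (0 : E N) 1, |u x - h x| ≤ ε := by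
  by_contra! hcon
  have hη : ∀ n : ℕ, 1 / ((n : ℝ) + 2) ∈ Set.Ioo (0 : ℝ) 1 := fun n => by
    refine ⟨by positivity, ?_⟩
    rw [div_lt_one (by positivity)]
    linarith [n.cast_nonneg (α := ℝ)]
  -- The factor `1 - α` keeps these thresholds above `1 + α`.
  have hσ : ∀ n : ℕ, 2 - (1 - α) * (1 / ((n : ℝ) + 2)) ∈ Set.Ioo (1 + α) 2 := fun n => by
    have h1 := hη n
    have h2 : 0 < 1 - α := by linarith [hα.2]
    constructor <;> nlinarith [h1.1, h1.2]
  choose σ hσ' ι κ hι hκ K k p u hu hfar using fun n => hcon _ (hη n) _ (hσ n)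
  have hlim0 : Tendsto (fun n : ℕ => 1 / ((n : ℝ) + 2)) atTop (𝓝 0) :=
    tendsto_const_nhds.div_atTop
      (tendsto_atTop_add_const_right _ _ tendsto_natCast_atTop_atTop)
  have hσlim : Tendsto σ atTop (𝓝 2) := by
    have h1 : Tendsto (fun n : ℕ => 2 - (1 - α) * (1 / ((n : ℝ) + 2))) atTop (𝓝 2) := by
      simpa using (hlim0.const_mul (1 - α)).const_sub 2
    exact tendsto_of_tendsto_of_tendsto_of_le_of_le h1 tendsto_const_nhds
      (fun n => (hσ' n).1.le) fun n => (hσ' n).2.le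
  obtain ⟨u₀, θ, hθ, hlim⟩ := exists_uniform_limit hω (M := 2 * M)
    (fun n => continuous_iff_lower_upperSemicontinuous.mpr ⟨(hu n).super.lsc, (hu n).sub.usc⟩)
    (fun n => (hu n).modulus) (fun n x hx => by
      refine ((hu n).growth x).trans ?_
      have : ‖x‖ ^ (1 + α) ≤ 1 := Real.rpow_le_one (norm_nonneg _)
        (mem_closedBall_zero_iff.mp hx) (by linarith [hα.1])
      nlinarith)
  have hharm := isViscosityHarmonic_of_tendsto hγ hlam hLam hM hα hω
    (hlim0.comp hθ.tendsto_atTop) (fun n => (hσ' (θ n)).2) (hσlim.comp hθ.tendsto_atTop)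
    (fun n => ⟨ι (θ n), κ (θ n), hι _, hκ _, K (θ n), k (θ n), hu (θ n)⟩) hlim
  obtain ⟨n, hn⟩ := (Metric.tendstoUniformlyOn_iff.mp hlim ε hε).exists
  obtain ⟨x, hx, hxε⟩ := hfar (θ n) u₀ hharm
  have := hn x (ball_subset_closedBall hx)
  rw [dist_comm, Real.dist_eq] at this
  linarith

end NonlocalIsaacs

theorem lemma3p1 (N : ℕ) [NeZero N] (γ : ℝ) (hγ : 0 < γ) (lam Lam : ℝ)
    (hlam : 0 < lam) (hLam : lam ≤ Lam) (M : ℝ) (hM : 0 < M)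
    (ε : ℝ) (hε : ε ∈ Set.Ioo (0 : ℝ) 1) (α : ℝ) (hα : α ∈ Set.Ioo (0 : ℝ) 1)
    (ω : ℝ≥0 → ℝ≥0) (hω0 : ω 0 = 0) (hω : Tendsto ω (𝓝 0) (𝓝 0)) :
    ∃ η ∈ Set.Ioo (0 : ℝ) 1, ∃ σ₀ ∈ Set.Ioo (1 + α) 2,
      ∀ σ ∈ Set.Ioo σ₀ 2, ∀ (ι : Type*) (κ : Type*) [Nonempty ι] [Nonempty κ]
        (K : ι → κ → E N → ℝ) (k : ι → κ → ℝ),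
        (∀ i j, IsEllipticKernel lam Lam σ (K i j)) →
        (∀ i j, k i j ∈ Set.Icc lam Lam) →
        (∀ i j, ∀ z : E N, z ≠ 0 → ‖z‖ ≤ 1 →
          |K i j z * ‖z‖ ^ ((N : ℝ) + σ) / normConst N σ - k i j| ≤ ω ‖z‖₊) →
        ∀ (p : E N) (u : E N → ℝ),
          IsNonlocalSubsolution γ p K (fun _ => η) u →
          IsNonlocalSupersolution γ p K (fun _ => -η) u →
          (∀ x ∈ Metric.closedBall (0 : E N) 1, ∀ y ∈ Metric.closedBall (0 : E N) 1,
            |u x - u y| ≤ ω ‖x - y‖₊) →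
          (∀ x, |u x| ≤ M * (1 + ‖x‖ ^ (1 + α))) →
          ∃ h : E N → ℝ, IsLimitSolution γ k h ∧
            ∀ x ∈ Metric.ball (0 : E N) 1, |u x - h x| ≤ ε := by
  obtain ⟨η, hη, σ₀, hσ₀, hmain⟩ :=
    exists_viscosityHarmonic_near (N := N) hγ hlam hLam hM hα hω hε.1
  refine ⟨η, hη, σ₀, hσ₀, fun σ hσ ι κ _ _ K k hK hk hclose p u hsub hsup hmod hgrow => ?_⟩
  obtain ⟨h, hh, hclose'⟩ :=
    hmain σ hσ ι κ K k p u ⟨hK, hk, hclose, hsub, hsup, hmod, hgrow⟩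
  exact ⟨h, hh.isLimitSolution γ fun i j => hlam.le.trans (hk i j).1, hclose'⟩
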